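/- For integers $m,n\ge 1$ let $K^m_n$ be the loopless multigraph on $[n]=\{1,\dots,n\}$ having, for every $1\le i<j\le n$, exactly $m$ edges between $j$ and $i$, written $ji^{(a)}$ and labelled $a=1,\dots,m$. The uniform attachment graph $G^m_n$ is the random subgraph of $K^m_n$ with vertex set $[n]$ obtained by choosing, for every $j\in\{2,\dots,n\}$ and every $a\in[m]$, exactly one of the edges $ji^{(a)}$, $i\in[j-1]$, uniformly at random, all choices being independent. A copy of a graph $H$ in a multigraph $G$ is a subgraph of $G$ isomorphic to $H$ (parallel edges are distinguished). A potential copy of $H$ in $G^m_n$ is a copy of $H$ in $K^m_n$ that does not contain two different edges $ji_1^{(a)}$, $ji_2^{(a)}$ with $i_1,i_2<j$ and the same label $a$. Let $m_H$ be the least integer $m\ge 1$ such that for some $n$ there is a potential copy of $H$ in $G^m_n$. Theorem 3.7. Let $H$ be a finite connected loopless multigraph that is multicyclic, i.e. contains at least two different (not necessarily edge- or vertex-disjoint) cycles, where a pair of parallel edges counts as a cycle of length $2$. Let $H'$ be the $2$-core of $H$, i.e. the largest subgraph of $H$ in which every vertex has degree at least $2$, so that $H$ is obtained from $H'$ by attaching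 trees, and let $t\ge 0$ be the number of vertices of $H$ outside $H'$ (equivalently, the total number of edges of the attached trees). Let $m\ge m_H$ be a positive integer, and let $W_n$ be the number of copies of $H$ in $G^m_n$. Then, as $n\to\infty$ with $H$ and $m$ fixed, $$\mathbb{E}\, W_n=\Theta\bigl(\log^{t} n\bigr),\qquad \operatorname{Var}(W_n)=O\bigl(\log^{2t} n\bigr).$$ -/

import Mathlib

open scoped Graph

namespace UniformAttachment

open MeasureTheory ProbabilityTheory

/-! ### Multigraphs

Graphs are Mathlib's multigraphs `Graph α β`, with vertices in `α` and edges in `β`; a subgraph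
relation `K ≤ G` means `V(K) ⊆ V(G)`, and every edge of `K` is an edge of `G` with the same ends. -/

section Multigraph

variable {α β α' β' : Type*}

/-- The degree of a vertex: the number of incident edges, where a loop counts twice. -/
noncomputable def degree (G : Graph α β) (v : α) : ℕ∞ :=
  (G.incidenceSet v).encard + (G.loopSet v).encard

/-- A multigraph is connected if it has a vertex and any two of its vertices are joined by a
walk. -/
def IsConnected (G : Graph α β) : Prop :=
  V(G).Nonempty ∧ ∀ x ∈ V(G), ∀ y ∈ V(G), Relation.ReflTransGen G.Adj x y

/-- A cycle: a finite connected multigraph in which every vertex has degree `2`. In particular a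
pair of parallel edges is a cycle (of length `2`). -/
def IsCycle (C : Graph α β) : Prop :=
  V(C).Finite ∧ IsConnected C ∧ ∀ v ∈ V(C), degree C v = 2

/-- A multigraph is multicyclic if it contains at least two different cycles, which need not be
edge- or vertex-disjoint. -/
def IsMulticyclic (G : Graph α β) : Prop :=
  ∃ C₁ C₂ : Graph α β, C₁ ≤ G ∧ C₂ ≤ G ∧ IsCycle C₁ ∧ IsCycle C₂ ∧ C₁ ≠ C₂

/-- Every vertex has degree at least `2`. -/
def MinDegreeTwo (G : Graph α β) : Prop :=
  ∀ v ∈ V(G), 2 ≤ degree G v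

/-- The `2`-core of `G`: the largest subgraph of `G` in which every vertex has degree at least `2`,
namely the union of all such subgraphs (see `isGreatest_twoCore`). -/
def twoCore (G : Graph α β) : Graph α β where
  vertexSet := {v | ∃ K ≤ G, MinDegreeTwo K ∧ v ∈ V(K)}
  IsLink e x y := ∃ K ≤ G, MinDegreeTwo K ∧ K.IsLink e x y
  isLink_symm _ _ := ⟨fun _ _ ⟨K, hK, h, hl⟩ => ⟨K, hK, h, hl.symm⟩⟩
  eq_or_eq_of_isLink_of_isLink := by
    rintro e x y v w ⟨K, hK, -, hl⟩ ⟨L, hL, -, hl'⟩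
    exact (hK.isLink_mono hl).left_eq_or_eq (hL.isLink_mono hl')
  left_mem_of_isLink := by
    rintro e x y ⟨K, hK, h, hl⟩
    exact ⟨K, hK, h, hl.left_mem⟩

lemma isGreatest_twoCore (G : Graph α β) :
    IsGreatest {K | K ≤ G ∧ MinDegreeTwo K} (twoCore G) := by
  have key : ∀ K, K ≤ G → MinDegreeTwo K → K ≤ twoCore G := fun K hK h =>
    ⟨fun v hv => ⟨K, hK, h, hv⟩, fun e x y hl => ⟨K, hK, h, hl⟩⟩
  refine ⟨⟨⟨?_, ?_⟩, ?_⟩, fun K hK => key K hK.1 hK.2⟩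
  · rintro v ⟨K, hK, -, hv⟩
    exact hK.vertexSet_mono hv
  · rintro e x y ⟨K, hK, -, hl⟩
    exact hK.isLink_mono hl
  · rintro v ⟨K, hK, h, hv⟩
    refine (h v hv).trans (add_le_add (Set.encard_le_encard ?_) (Set.encard_le_encard ?_))
    · rintro e ⟨y, hy⟩
      exact ⟨y, (key K hK h).isLink_mono hy⟩
    · intro e he
      exact (key K hK h).isLink_mono he

/-- Two multigraphs are isomorphic: there are bijections between their vertices and between their
edges that preserve incidence. -/
def Isomorphic (G : Graph α β) (H : Graph α' β') : Prop :=
  ∃ (f : V(G) ≃ V(H)) (g : E(G) ≃ E(H)), ∀ (e : E(G)) (x y : V(G)),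
    G.IsLink (e : β) (x : α) (y : α) ↔ H.IsLink (g e : β') (f x : α') (f y : α')

/-- The copies of `H` in `G`: the subgraphs of `G` that are isomorphic to `H`. -/
def copies (H : Graph α β) (G : Graph α' β') : Set (Graph α' β') :=
  {K | K ≤ G ∧ Isomorphic K H}

end Multigraph

/-! ### The uniform attachment graph -/

/-- The `m`-fold complete multigraph `K^m_n` on `{1, …, n}`. For `1 ≤ i < j ≤ n` and each of the `m`
labels `a`, the triple `(j, i, a)` is an edge joining `j` to `i`. -/
def completeMultigraph (m n : ℕ) : Graph ℕ (ℕ × ℕ × Fin m) where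
  vertexSet := Set.Icc 1 n
  IsLink e x y := (1 ≤ e.2.1 ∧ e.2.1 < e.1 ∧ e.1 ≤ n) ∧
    ((x = e.1 ∧ y = e.2.1) ∨ (x = e.2.1 ∧ y = e.1))
  isLink_symm _ _ := ⟨fun _ _ h => ⟨h.1, h.2.symm.imp And.symm And.symm⟩⟩
  eq_or_eq_of_isLink_of_isLink := by grind
  left_mem_of_isLink := by
    rintro e x y ⟨h, h'⟩
    simp only [Set.mem_Icc]
    omega

/-- The outcomes of all the choices: each vertex `j ∈ {2, …, n}` chooses, for each label `a`, a
vertex in `{1, …, j - 1}`. -/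
abbrev Choices (m n : ℕ) : Type :=
  (p : Finset.Icc 2 n × Fin m) → Finset.Icc 1 ((p.1 : ℕ) - 1)

/-- All choices are uniformly random and independent. -/
noncomputable def choiceMeasure (m n : ℕ) : Measure (Choices m n) :=
  Measure.pi fun _ => uniformOn Set.univ

/-- The uniform attachment graph `G^m_n`: the subgraph of `K^m_n` on all `n` vertices whose edges
are the edges `(j, i, a)` for which `j` has chosen `i` for the label `a`. -/
def attachmentGraph (m n : ℕ) (ω : Choices m n) : Graph ℕ (ℕ × ℕ × Fin m) :=
  (completeMultigraph m n).restrict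
    {e | ∃ h : e.1 ∈ Finset.Icc 2 n, (ω (⟨e.1, h⟩, e.2.2) : ℕ) = e.2.1}

variable {α β : Type*}

/-- The number `W_n` of copies of `H` in `G^m_n`, a random variable. -/
noncomputable def copyCount (H : Graph α β) (m n : ℕ) (ω : Choices m n) : ℝ :=
  (copies H (attachmentGraph m n ω)).ncard

/-- The potential copies of `H` in `G^m_n`: the copies of `H` in `K^m_n` that do not contain two
different edges from the same vertex to smaller vertices with the same label. -/
def potentialCopies (H : Graph α β) (m n : ℕ) : Set (Graph ℕ (ℕ × ℕ × Fin m)) :=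
  {K ∈ copies H (completeMultigraph m n) |
    ∀ e ∈ E(K), ∀ f ∈ E(K), e.1 = f.1 → e.2.2 = f.2.2 → e = f}

/-- `m_H`: the least `m ≥ 1` such that for some `n` there is a potential copy of `H` in `G^m_n`. -/
noncomputable def minLabels (H : Graph α β) : ℕ :=
  sInf {m | 1 ≤ m ∧ ∃ n, (potentialCopies H m n).Nonempty}

end UniformAttachment

/-! A set of edges free of label conflicts is present with probability equal to the product of
`1/(j-1)` over the larger ends `j` of its edges, so both moments are sums of such products.

Upper bounds. Because `H` is connected and multicyclic, every vertex set `S` touches at least `|S|`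
edges, and at least `|S| + 1` if `S` meets the 2-core (`ncard_le_ncard_touching`). This expansion
passes to unions of two copies (`Expands.union`). Applied to the sets of vertices beyond a
threshold, it bounds the product of the larger ends from below by the product of all vertices, with
an extra exponent `ε` on core vertices (`sum_mul_log_le`, `prod_inv_le_of_expands`). Sums over core
positions therefore converge, while each tree vertex costs a harmonic sum, about `log n`. A pair of
copies has at most `2t` vertices outside the two cores, so the second moment is `O(log^(2t) n)`
(`exists_integral_copyCount_sq_le`). This dominates both the variance and the square of the mean.

Lower bound. The core stays at the fixed position it has in some potential copy. The tree vertices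
are peeled off one by one (`exists_elimination_rank`), and the vertex of rank `r` ranges over the
block `(n₀ b^(r-1), n₀ b^r]`. Each tree edge then has its own larger end, so one label serves them
all, and each block contributes at least `log b`. Taking `b` near `n^(1/(t+1))` gives order `log^t
n` (`exists_log_pow_le_integral_copyCount`). -/

namespace UniformAttachment

open MeasureTheory ProbabilityTheory Filter

/-! ### Expansion of connected multicyclic graphs and peeling of the trees -/

section Expansion

variable {α β : Type*} {G H : Graph α β}

/-- The edges incident with at least one vertex of `S`. -/
def touching (G : Graph α β) (S : Set α) : Set β := {e | ∃ v ∈ S, G.Inc e v}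

lemma touching_subset_edgeSet (G : Graph α β) (S : Set α) : touching G S ⊆ E(G) := by
  rintro e ⟨v, -, h⟩
  exact h.edge_mem

lemma touching_mono (G : Graph α β) {S S' : Set α} (h : S ⊆ S') : touching G S ⊆ touching G S' :=
  fun _ ⟨v, hv, he⟩ => ⟨v, h hv, he⟩

lemma touching_vertexSet (G : Graph α β) : touching G V(G) = E(G) := by
  refine (touching_subset_edgeSet G _).antisymm fun e he => ?_
  obtain ⟨x, y, h⟩ := Graph.exists_isLink_of_mem_edgeSet he
  exact ⟨x, h.left_mem, h.inc_left⟩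

lemma exists_isLink_of_ssubset (hconn : IsConnected G) {S : Set α} (hne : S.Nonempty)
    (hS : S ⊂ V(G)) : ∃ e, ∃ s ∈ S, ∃ u ∉ S, G.IsLink e s u := by
  obtain ⟨x, hx⟩ := hne
  obtain ⟨y, hy, hyS⟩ := Set.exists_of_ssubset hS
  by_contra! hno
  have : ∀ z, Relation.ReflTransGen G.Adj x z → z ∈ S := by
    intro z hz
    induction hz with
    | refl => exact hx
    | tail _ hadj ih =>
      obtain ⟨e, he⟩ := hadj
      by_contra hc
      exact hno e _ ih _ hc he
  exact hyS (this y (hconn.2 x (hS.1 hx) y hy))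

/-- A proper vertex subset `S` of a connected graph touches `|S|` edges forming a forest in which
every component leaves `S`. -/
lemma exists_forest (hconn : IsConnected G) (S : Finset α) (hS : (S : Set α) ⊂ V(G)) :
    ∃ T : Finset β, (T : Set β) ⊆ touching G S ∧ T.card = S.card ∧
      ∀ D : Set β, D ⊆ T →
        (∀ v ∈ S, ∀ e ∈ D, G.Inc e v → ∃ e' ∈ D, e' ≠ e ∧ G.Inc e' v) → D = ∅ := by
  classical
  induction hn : S.card generalizing S with
  | zero =>
    exact ⟨∅, by simp, by simp, fun D hD _ => by simpa using hD⟩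
  | succ n ih =>
    have hne : (S : Set α).Nonempty := by
      rw [Finset.coe_nonempty, ← Finset.card_pos]
      omega
    -- Peel off `s`, which has an edge `f` leaving `S`. This `f` touches no other vertex of `S`, so
    -- it is new to the forest of `S.erase s`.
    obtain ⟨f, s, hs, u, hu, hf⟩ := exists_isLink_of_ssubset hconn hne hS
    have hs' : s ∈ S := hs
    obtain ⟨T, hT, hTc, hD⟩ := ih (S.erase s)
      (lt_of_le_of_lt (by simp) hS)
      (by rw [Finset.card_erase_of_mem hs']; omega)
    have hfS : ∀ v ∈ S.erase s, ¬ G.Inc f v := by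
      intro v hv hinc
      rcases hinc.eq_or_eq_of_isLink hf with rfl | rfl
      · simp at hv
      · exact hu (Finset.mem_of_mem_erase hv)
    have hfT : f ∉ T := by
      intro h
      obtain ⟨v, hv, hinc⟩ := hT h
      exact hfS v hv hinc
    refine ⟨insert f T, ?_, by rw [Finset.card_insert_of_notMem hfT, hTc], ?_⟩
    · rw [Finset.coe_insert]
      refine Set.insert_subset ⟨s, hs, hf.inc_left⟩ (hT.trans (touching_mono _ ?_))
      simp
    · intro D hDT hdeg
      -- Dropping `f` changes nothing at the vertices of `S.erase s`, so induction leaves `D ⊆ {f}`;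
      -- but `f` alone would be a dangling edge at `s`.
      have h0 : D \ {f} = ∅ := by
        refine hD _ ?_ ?_
        · intro e he
          have := hDT he.1
          simp only [Finset.coe_insert] at this
          exact this.resolve_left he.2
        · intro v hv e he hinc
          obtain ⟨e', he', hne', hinc'⟩ := hdeg v (Finset.mem_of_mem_erase hv) e he.1 hinc
          refine ⟨e', ⟨he', ?_⟩, hne', hinc'⟩
          rintro rfl
          exact hfS v hv hinc'
      rw [Set.sdiff_eq_empty] at h0
      by_contra hcon
      obtain ⟨e, he⟩ := Set.nonempty_iff_ne_empty.2 hcon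
      obtain rfl : e = f := h0 he
      obtain ⟨e', he', hne', -⟩ := hdeg s hs' e he hf.inc_left
      exact hne' (h0 he')

lemma degree_eq_encard [G.Loopless] (v : α) : degree G v = (G.incidenceSet v).encard := by
  have : G.loopSet v = ∅ := by
    ext e
    simp
  rw [degree, this, Set.encard_empty, add_zero]

lemma MinDegreeTwo.exists_ne [G.Loopless] (h : MinDegreeTwo G) {v : α} (hv : v ∈ V(G)) (e : β) :
    ∃ e', e' ≠ e ∧ G.Inc e' v := by
  have h2 := h v hv
  rw [degree_eq_encard] at h2
  obtain ⟨e', he', hne⟩ :=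
    Set.exists_ne_of_one_lt_encard (lt_of_lt_of_le (by norm_num) h2) e
  exact ⟨e', hne, he'⟩

lemma IsCycle.minDegreeTwo {C : Graph α β} (h : IsCycle C) : MinDegreeTwo C :=
  fun v hv => (h.2.2 v hv).ge

lemma twoCore_le (G : Graph α β) : twoCore G ≤ G := (isGreatest_twoCore G).1.1

lemma minDegreeTwo_twoCore (G : Graph α β) : MinDegreeTwo (twoCore G) := (isGreatest_twoCore G).1.2

/-- The symmetric difference of two cycles has no dangling edge. If the second edge of `C₁` at `v`
also lies in `C₂`, then `C₂` has another edge at `v`, which cannot be a third edge of `C₁` there. -/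
lemma IsCycle.symmDiff_exists_ne [H.Loopless] {C₁ C₂ : Graph α β} (h₁ : C₁ ≤ H) (h₂ : C₂ ≤ H)
    (hC₁ : IsCycle C₁) (hC₂ : IsCycle C₂) {e : β} {v : α} (he : e ∈ E(C₁) \ E(C₂))
    (hinc : H.Inc e v) :
    ∃ e' ∈ symmDiff E(C₁) E(C₂), e' ≠ e ∧ H.Inc e' v := by
  have : C₁.Loopless := Graph.Loopless.anti h₁
  have : C₂.Loopless := Graph.Loopless.anti h₂
  have hinc₁ : C₁.Inc e v := (h₁.inc_congr he.1).2 hinc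
  obtain ⟨e₁, hne₁, hinc₁'⟩ := hC₁.minDegreeTwo.exists_ne hinc₁.vertex_mem e
  by_cases he₁ : e₁ ∈ E(C₂)
  · have hinc₂ : C₂.Inc e₁ v := (h₂.inc_congr he₁).2 (hinc₁'.mono h₁)
    obtain ⟨e₂, hne₂, hinc₂'⟩ := hC₂.minDegreeTwo.exists_ne hinc₂.vertex_mem e₁
    have hne₃ : e₂ ≠ e := by
      rintro rfl
      exact he.2 hinc₂'.edge_mem
    refine ⟨e₂, Or.inr ⟨hinc₂'.edge_mem, fun hmem => ?_⟩, hne₃, hinc₂'.mono h₂⟩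
    have hdeg := hC₁.2.2 v hinc₁.vertex_mem
    rw [degree_eq_encard] at hdeg
    have h3 : ({e, e₁, e₂} : Set β).encard ≤ (C₁.incidenceSet v).encard := by
      refine Set.encard_le_encard ?_
      rintro x (rfl | rfl | rfl)
      · exact hinc₁
      · exact hinc₁'
      · exact (h₁.inc_congr hmem).2 (hinc₂'.mono h₂)
    rw [hdeg, Set.encard_eq_three.2 ⟨e, e₁, e₂, hne₁.symm, hne₃.symm, hne₂.symm, rfl⟩] at h3
    exact absurd h3 (by norm_num)
  · exact ⟨e₁, Or.inl ⟨hinc₁'.edge_mem, he₁⟩, hne₁, hinc₁'.mono h₁⟩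

/-- A connected multicyclic graph has more edges than vertices. -/
lemma ncard_vertexSet_lt_ncard_edgeSet (hV : V(H).Finite) (hE : E(H).Finite) [H.Loopless]
    (hconn : IsConnected H) (hmulti : IsMulticyclic H) : V(H).ncard + 1 ≤ E(H).ncard := by
  classical
  obtain ⟨C₁, C₂, h₁, h₂, hC₁, hC₂, hne⟩ := hmulti
  obtain ⟨r, hr⟩ := hconn.1
  obtain ⟨T, hT, hTc, hD⟩ := exists_forest hconn (hV.toFinset.erase r)
    (by
      rw [Finset.coe_erase, Set.Finite.coe_toFinset]
      exact Set.ssubset_iff_of_subset Set.sdiff_subset |>.2 ⟨r, hr, by simp⟩)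
  rw [Finset.card_erase_of_mem (by simpa using hr), ← Set.ncard_eq_toFinset_card _ hV] at hTc
  by_contra! hcard
  have hTE : (T : Set β) ⊆ E(H) := hT.trans (touching_subset_edgeSet _ _)
  -- `T` is a spanning tree with `|V| - 1` edges, so under the contrary assumption at most one edge
  -- lies outside it.
  have hrest : (E(H) \ T).Subsingleton := by
    have := Set.ncard_sdiff hTE T.finite_toSet
    rw [Set.ncard_coe_finset, hTc] at this
    have hfin : (E(H) \ (T : Set β)).Finite := hE.sdiff
    rw [← Set.encard_le_one_iff_subsingleton, ← hfin.cast_ncard_eq]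
    exact_mod_cast (by omega : (E(H) \ (T : Set β)).ncard ≤ 1)
  have key : ∀ D : Set β, D ⊆ T → (∀ v, ∀ e ∈ D, H.Inc e v → ∃ e' ∈ D, e' ≠ e ∧ H.Inc e' v) →
      D = ∅ := fun D hDT h => hD D hDT fun v _ => h v
  have notin : ∀ C ≤ H, IsCycle C → ∃ g ∈ E(C), g ∈ E(H) \ T := by
    intro C hCH hC
    have : C.Loopless := Graph.Loopless.anti hCH
    by_contra! hno
    have h0 : E(C) = ∅ := by
      refine key _ (fun e he => ?_) fun v e he hinc => ?_
      · by_contra hc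
        exact hno e he ⟨hCH.edgeSet_mono he, hc⟩
      · obtain ⟨e', hne', hinc'⟩ :=
          hC.minDegreeTwo.exists_ne ((hCH.inc_congr he).2 hinc).vertex_mem e
        exact ⟨e', hinc'.edge_mem, hne', hinc'.mono hCH⟩
    obtain ⟨v, hv⟩ := hC.2.1.1
    have hd := hC.2.2 v hv
    have hinc : C.incidenceSet v = ∅ :=
      Set.subset_empty_iff.1 ((C.incidenceSet_subset_edgeSet v).trans h0.le)
    rw [degree_eq_encard, hinc] at hd
    simp at hd
  obtain ⟨g, hg₁, hgT⟩ := notin C₁ h₁ hC₁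
  obtain ⟨g', hg₂, hgT'⟩ := notin C₂ h₂ hC₂
  obtain rfl := hrest hgT hgT'
  -- Both cycles use the only edge outside `T`, so their symmetric difference lies in the tree and,
  -- having no dangling edge, is empty.
  have hsd : symmDiff E(C₁) E(C₂) = ∅ := by
    refine key _ (fun e he => ?_) fun v e he hinc => ?_
    · by_contra hc
      have heH : e ∈ E(H) := by
        rcases he with he | he
        · exact h₁.edgeSet_mono he.1
        · exact h₂.edgeSet_mono he.1
      obtain rfl := hrest hgT ⟨heH, hc⟩
      rcases he with he | he
      · exact he.2 hg₂
      · exact he.2 hg₁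
    · rcases he with he | he
      · exact IsCycle.symmDiff_exists_ne h₁ h₂ hC₁ hC₂ he hinc
      · rw [symmDiff_comm]
        exact IsCycle.symmDiff_exists_ne h₂ h₁ hC₂ hC₁ he hinc
  have hEeq : E(C₁) = E(C₂) := symmDiff_eq_bot.1 hsd
  have hsub : ∀ {C C' : Graph α β}, C ≤ H → C' ≤ H → IsCycle C → E(C) = E(C') →
      V(C) ⊆ V(C') := by
    intro C C' hCH hCH' hC hCC' v hv
    have : C.Loopless := Graph.Loopless.anti hCH
    obtain ⟨e, -, he⟩ := hC.minDegreeTwo.exists_ne hv g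
    exact ((hCH'.inc_congr (hCC' ▸ he.edge_mem)).2 (he.mono hCH)).vertex_mem
  exact hne (Graph.Compatible.ext
    ((hsub h₁ h₂ hC₁ hEeq).antisymm (hsub h₂ h₁ hC₂ hEeq.symm)) hEeq
    (Graph.Compatible.of_le_le h₁ h₂))

/-- Every vertex set `S` of a connected multicyclic graph touches at least `|S|` edges, and at least
`|S| + 1` edges if it meets the `2`-core. -/
lemma ncard_le_ncard_touching (hV : V(H).Finite) (hE : E(H).Finite) [H.Loopless]
    (hconn : IsConnected H) (hmulti : IsMulticyclic H) {S : Set α} (hS : S ⊆ V(H)) :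
    S.ncard ≤ (touching H S).ncard ∧
      ((S ∩ V(twoCore H)).Nonempty → S.ncard + 1 ≤ (touching H S).ncard) := by
  rcases hS.eq_or_ssubset with rfl | hss
  · have := ncard_vertexSet_lt_ncard_edgeSet hV hE hconn hmulti
    rw [touching_vertexSet]
    exact ⟨by omega, fun _ => this⟩
  have hSf : S.Finite := hV.subset hS
  have hfin : (touching H S).Finite := hE.subset (touching_subset_edgeSet _ _)
  obtain ⟨T, hT, hTc, hD⟩ := exists_forest hconn hSf.toFinset (by simpa using hss)
  rw [Set.Finite.coe_toFinset] at hT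
  rw [← Set.ncard_eq_toFinset_card _ hSf] at hTc
  have hle : S.ncard ≤ (touching H S).ncard := by
    rw [← hTc, ← Set.ncard_coe_finset]
    exact Set.ncard_le_ncard hT hfin
  refine ⟨hle, fun ⟨v, hvS, hvC⟩ => ?_⟩
  by_contra! hlt
  -- With no spare edge, the forest is everything that touches `S`. The core edges touching `S`
  -- would then be a subset without dangling edges, hence empty, although `v` has core degree at
  -- least 2.
  have hTeq : (T : Set β) = touching H S := by
    refine Set.eq_of_subset_of_ncard_le hT ?_ hfin
    rw [Set.ncard_coe_finset]
    omega
  have : (twoCore H).Loopless := Graph.Loopless.anti (twoCore_le H)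
  have h0 : touching (twoCore H) S = ∅ := by
    refine hD _ ?_ ?_
    · rw [hTeq]
      rintro e ⟨w, hw, he⟩
      exact ⟨w, hw, he.mono (twoCore_le H)⟩
    · intro w hw e he hinc
      have hinc' := ((twoCore_le H).inc_congr (touching_subset_edgeSet _ _ he)).2 hinc
      obtain ⟨e', hne', he'⟩ := (minDegreeTwo_twoCore H).exists_ne hinc'.vertex_mem e
      exact ⟨e', ⟨w, by simpa using hw, he'⟩, hne', he'.mono (twoCore_le H)⟩
  have hd := minDegreeTwo_twoCore H v hvC
  rw [degree_eq_encard] at hd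
  have : (twoCore H).incidenceSet v = ∅ :=
    Set.subset_empty_iff.1 fun e he => h0 ▸ ⟨v, hvS, he⟩
  rw [this] at hd
  simp at hd

/-- The vertices outside the `2`-core can be ranked so that every edge outside the `2`-core joins a
vertex, its top, to a vertex of smaller rank, and different such edges have different tops. -/
lemma exists_elimination_rank (hV : V(H).Finite) (hne : V(H).Nonempty) [H.Loopless] :
    ∃ (r : α → ℕ) (top : β → α), (∀ v ∈ V(twoCore H), r v = 0) ∧
      (∀ v ∈ V(H) \ V(twoCore H), 1 ≤ r v ∧ r v ≤ (V(H) \ V(twoCore H)).ncard) ∧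
      Set.InjOn r (V(H) \ V(twoCore H)) ∧
      (∀ e ∈ E(H) \ E(twoCore H), top e ∈ V(H) \ V(twoCore H) ∧
        ∃ u, H.IsLink e (top e) u ∧ r u < r (top e)) ∧
      Set.InjOn top (E(H) \ E(twoCore H)) := by
  classical
  set C := V(twoCore H) with hC
  have hCV : C ⊆ V(H) := (twoCore_le H).vertexSet_mono
  -- The last clause says that `v` has at most one edge to vertices of smaller rank; it makes the
  -- tops of the tree edges distinct.
  have peel : ∀ T : Finset α, (T : Set α) ⊆ V(H) \ C → ∃ r : α → ℕ, (∀ v ∈ C, r v = 0) ∧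
      (∀ v ∈ T, 1 ≤ r v ∧ r v ≤ T.card) ∧ Set.InjOn r T ∧
      ∀ v ∈ T, ∀ e e' u u', H.IsLink e v u → H.IsLink e' v u' → u ∈ C ∪ T → u' ∈ C ∪ T →
        r u < r v → r u' < r v → e = e' := by
    intro T hT
    induction hn : T.card generalizing T with
    | zero =>
      obtain rfl := Finset.card_eq_zero.1 hn
      exact ⟨fun _ => 0, by simp⟩
    | succ n ih =>
      have hX : C ∪ T ⊆ V(H) := Set.union_subset hCV (hT.trans Set.sdiff_subset)
      have hIH : H.induce (C ∪ T) ≤ H := Graph.induce_le hX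
      have : (H.induce (C ∪ T)).Loopless := Graph.Loopless.anti hIH
      -- Some vertex has at most one edge inside `C ∪ T`, since otherwise the induced graph would
      -- lie in the 2-core. It is not a core vertex, so it can be peeled from `T` and given the
      -- largest rank.
      obtain ⟨v, hv, hdeg⟩ : ∃ v ∈ C ∪ T, ((H.induce (C ∪ T)).incidenceSet v).Subsingleton := by
        by_contra! hno
        have hmin : MinDegreeTwo (H.induce (C ∪ T)) := by
          intro v hv
          have h1 := hno v hv
          rw [← Set.one_lt_encard_iff_nontrivial] at h1
          rw [degree_eq_encard]
          exact Order.add_one_le_of_lt h1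
        have hle := ((isGreatest_twoCore H).2 ⟨hIH, hmin⟩).vertexSet_mono
        obtain ⟨w, hw⟩ : T.Nonempty := by
          rw [← Finset.card_pos]
          omega
        exact (hT hw).2 (hle (Or.inr hw))
      have hvT : v ∈ T := by
        refine hv.resolve_left fun hvC => ?_
        have hle : twoCore H ≤ H.induce (C ∪ T) :=
          ⟨Set.subset_union_left, fun e x y h =>
            ⟨h.mono (twoCore_le H), Or.inl h.left_mem, Or.inl h.right_mem⟩⟩
        have : (twoCore H).Loopless := Graph.Loopless.anti (twoCore_le H)
        have h2 := minDegreeTwo_twoCore H v hvC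
        rw [degree_eq_encard] at h2
        have h1 : ((twoCore H).incidenceSet v).encard ≤ 1 := by
          refine Set.encard_le_one_iff_subsingleton.2 (hdeg.anti fun e he => ?_)
          exact Graph.Inc.mono hle he
        exact absurd (h2.trans h1) (by norm_num)
      have hcard : (T.erase v).card = n := by
        rw [Finset.card_erase_of_mem hvT]
        omega
      obtain ⟨r, hr0, hrT, hinj, hr⟩ := ih (T.erase v)
        (fun w hw => hT (Finset.mem_of_mem_erase hw)) hcard
      have hsmall : ∀ w ∈ C ∪ T, w ≠ v → r w ≤ n := by
        rintro w (hw | hw) hwv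
        · rw [hr0 w hw]
          exact Nat.zero_le _
        · exact (hrT w (Finset.mem_erase.2 ⟨hwv, hw⟩)).2
      have hvC : ∀ w ∈ C, w ≠ v := fun w hw h => (hT hvT).2 (h ▸ hw)
      refine ⟨Function.update r v (n + 1), ?_, ?_, ?_, ?_⟩
      · intro w hw
        rw [Function.update_of_ne (hvC w hw), hr0 w hw]
      · intro w hw
        by_cases hwv : w = v
        · subst hwv
          simp
        · rw [Function.update_of_ne hwv]
          have := hrT w (Finset.mem_erase.2 ⟨hwv, hw⟩)
          omega
      · intro w hw w' hw' heq
        by_cases hwv : w = v <;> by_cases hwv' : w' = v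
        · rw [hwv, hwv']
        · subst hwv
          rw [Function.update_self, Function.update_of_ne hwv'] at heq
          have := hsmall w' (Or.inr hw') hwv'
          omega
        · subst hwv'
          rw [Function.update_self, Function.update_of_ne hwv] at heq
          have := hsmall w (Or.inr hw) hwv
          omega
        · rw [Function.update_of_ne hwv, Function.update_of_ne hwv'] at heq
          exact hinj (by simpa using ⟨hw, hwv⟩) (by simpa using ⟨hw', hwv'⟩) heq
      · intro w hw e e' u u' hl hl' hu hu' hlt hlt'
        by_cases hwv : w = v
        · subst hwv
          exact hdeg ⟨u, hl, Or.inr hw, hu⟩ ⟨u', hl', Or.inr hw, hu'⟩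
        · have hwle := hsmall w (Or.inr hw) hwv
          rw [Function.update_of_ne hwv] at hlt hlt'
          have huv : u ≠ v := by
            rintro rfl
            rw [Function.update_self] at hlt
            omega
          have huv' : u' ≠ v := by
            rintro rfl
            rw [Function.update_self] at hlt'
            omega
          rw [Function.update_of_ne huv] at hlt
          rw [Function.update_of_ne huv'] at hlt'
          refine hr w (Finset.mem_erase.2 ⟨hwv, hw⟩) e e' u u' hl hl' ?_ ?_ hlt hlt'
          · exact hu.imp id fun h => Finset.mem_coe.2 (Finset.mem_erase.2 ⟨huv, h⟩)
          · exact hu'.imp id fun h => Finset.mem_coe.2 (Finset.mem_erase.2 ⟨huv', h⟩)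
  have hAf : (V(H) \ C).Finite := hV.sdiff
  obtain ⟨r, hr0, hrA, hinj, hr⟩ := peel hAf.toFinset (by simp)
  rw [Set.Finite.coe_toFinset] at hinj
  rw [← Set.ncard_eq_toFinset_card _ hAf] at hrA
  have hrA' : ∀ v ∈ V(H) \ C, 1 ≤ r v ∧ r v ≤ (V(H) \ C).ncard := fun v hv =>
    hrA v (by simpa using hv)
  -- The 2-core is an induced subgraph, so every edge outside it has an end outside `C`.
  have hinduced : H.induce C ≤ twoCore H := by
    refine (isGreatest_twoCore H).2 ⟨Graph.induce_le hCV, fun v hv => ?_⟩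
    have : (twoCore H).Loopless := Graph.Loopless.anti (twoCore_le H)
    have : (H.induce C).Loopless := Graph.Loopless.anti (Graph.induce_le hCV)
    refine (minDegreeTwo_twoCore H v hv).trans ?_
    rw [degree_eq_encard, degree_eq_encard]
    refine Set.encard_le_encard ?_
    rintro e ⟨y, hy⟩
    exact ⟨y, hy.mono (twoCore_le H), hy.left_mem, hy.right_mem⟩
  have htop : ∀ e ∈ E(H) \ E(twoCore H), ∃ v ∈ V(H) \ C, ∃ u, H.IsLink e v u ∧ r u < r v := by
    rintro e ⟨he, heC⟩
    obtain ⟨x, y, h⟩ := Graph.exists_isLink_of_mem_edgeSet he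
    by_cases hx : x ∈ C <;> by_cases hy : y ∈ C
    · exact absurd (hinduced.isLink_mono ⟨h, hx, hy⟩).edge_mem heC
    · refine ⟨y, ⟨h.right_mem, hy⟩, x, h.symm, ?_⟩
      rw [hr0 x hx]
      exact (hrA' y ⟨h.right_mem, hy⟩).1
    · refine ⟨x, ⟨h.left_mem, hx⟩, y, h, ?_⟩
      rw [hr0 y hy]
      exact (hrA' x ⟨h.left_mem, hx⟩).1
    · have hne : r x ≠ r y := fun heq =>
        h.ne (hinj ⟨h.left_mem, hx⟩ ⟨h.right_mem, hy⟩ heq)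
      rcases hne.lt_or_gt with hlt | hlt
      · exact ⟨y, ⟨h.right_mem, hy⟩, x, h.symm, hlt⟩
      · exact ⟨x, ⟨h.left_mem, hx⟩, y, h, hlt⟩
  have : Nonempty α := hne.to_type
  choose! top htopA u hlink hlt using htop
  refine ⟨r, top, hr0, hrA', hinj, fun e he => ⟨htopA e he, u e, hlink e he, hlt e he⟩, ?_⟩
  intro e he e' he' heq
  have hmem : ∀ w ∈ V(H), w ∈ C ∪ (hAf.toFinset : Set α) := fun w hw => by
    by_cases h : w ∈ C
    · exact Or.inl h
    · exact Or.inr (by simpa using ⟨hw, h⟩)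
  refine hr (top e) (by simpa using htopA e he) e e' (u e) (u e') (hlink e he)
    (heq ▸ hlink e' he') (hmem _ (hlink e he).right_mem) (hmem _ (hlink e' he').right_mem)
    (hlt e he) (heq ▸ hlt e' he')

end Expansion

/-! ### Probabilities of edge sets and the moments as sums over copies -/

section Probability

variable {α β : Type*} {m n : ℕ}

instance (p : Finset.Icc 2 n × Fin m) : Nonempty (Finset.Icc 1 ((p.1 : ℕ) - 1)) := by
  have := Finset.mem_Icc.1 p.1.2
  exact ⟨⟨1, Finset.mem_Icc.2 ⟨le_rfl, by omega⟩⟩⟩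

instance : IsProbabilityMeasure (choiceMeasure m n) := by
  unfold choiceMeasure
  infer_instance

/-- The edges `(j, i, a)` such that `j` has chosen `i` for the label `a`. -/
def chosenEdges (ω : Choices m n) : Set (ℕ × ℕ × Fin m) :=
  {e | ∃ h : e.1 ∈ Finset.Icc 2 n, (ω (⟨e.1, h⟩, e.2.2) : ℕ) = e.2.1}

lemma mem_edgeSet_completeMultigraph {e : ℕ × ℕ × Fin m} :
    e ∈ E(completeMultigraph m n) ↔ 1 ≤ e.2.1 ∧ e.2.1 < e.1 ∧ e.1 ≤ n := by
  constructor
  · rintro ⟨x, y, h, -⟩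
    exact h
  · exact fun h => ⟨e.1, e.2.1, h, Or.inl ⟨rfl, rfl⟩⟩

/-- No vertex has two different edges of `F` to smaller vertices with the same label. -/
def LabelInjective (F : Set (ℕ × ℕ × Fin m)) : Prop :=
  Set.InjOn (fun e : ℕ × ℕ × Fin m => (e.1, e.2.2)) F

/-- Label injectivity makes the edges of `F` constrain distinct coordinates of the product measure,
so the event is a cylinder and its factors multiply. -/
lemma measure_subset_chosenEdges (F : Finset (ℕ × ℕ × Fin m))
    (hF : (F : Set (ℕ × ℕ × Fin m)) ⊆ E(completeMultigraph m n))
    (hinj : LabelInjective (F : Set (ℕ × ℕ × Fin m))) :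
    (choiceMeasure m n).real {ω | (F : Set (ℕ × ℕ × Fin m)) ⊆ chosenEdges ω} =
      ∏ e ∈ F, ((e.1 : ℝ) - 1)⁻¹ := by
  classical
  have hF' : ∀ e ∈ F, 1 ≤ e.2.1 ∧ e.2.1 < e.1 ∧ e.1 ≤ n := fun e he =>
    mem_edgeSet_completeMultigraph.1 (hF he)
  have hIcc : ∀ e ∈ F, e.1 ∈ Finset.Icc 2 n := fun e he => by
    have := hF' e he
    exact Finset.mem_Icc.2 ⟨by omega, by omega⟩
  let key : {e // e ∈ F} → Finset.Icc 2 n × Fin m := fun e => (⟨e.1.1, hIcc e.1 e.2⟩, e.1.2.2)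
  have hkey : Function.Injective key := by
    rintro ⟨e, he⟩ ⟨f, hf⟩ h
    simp only [key, Prod.mk.injEq, Subtype.mk.injEq] at h
    exact Subtype.ext (hinj he hf (Prod.ext h.1 h.2))
  let s : ∀ p : Finset.Icc 2 n × Fin m, Set (Finset.Icc 1 ((p.1 : ℕ) - 1)) := fun p =>
    {x | ∀ e ∈ F, e.1 = p.1 → e.2.2 = p.2 → (x : ℕ) = e.2.1}
  have hset : {ω : Choices m n | (F : Set (ℕ × ℕ × Fin m)) ⊆ chosenEdges ω} =
      Set.pi (Finset.univ.image key : Finset _) s := by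
    ext ω
    simp only [Set.mem_ofPred_eq, Set.mem_pi, Finset.coe_image, Finset.coe_univ, Set.image_univ,
      Set.mem_range, forall_exists_index, forall_apply_eq_imp_iff, s, key]
    constructor
    · rintro h ⟨e, he⟩ f hf h1 h2
      obtain rfl : f = e := hinj hf he (Prod.ext h1 h2)
      obtain ⟨_, h3⟩ := h hf
      exact h3
    · intro h e he
      exact ⟨hIcc e he, h ⟨e, he⟩ e he rfl rfl⟩
  rw [hset, Measure.real, choiceMeasure, Measure.pi_pi_finset, Finset.prod_image hkey.injOn,
    ENNReal.toReal_prod, ← Finset.prod_coe_sort F]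
  refine Finset.prod_congr rfl fun e _ => ?_
  have he := hF' e.1 e.2
  have hs : s (key e) = {⟨e.1.2.1, Finset.mem_Icc.2 ⟨he.1, Nat.le_sub_one_of_lt he.2.1⟩⟩} := by
    ext x
    simp only [s, Set.mem_ofPred_eq, Set.mem_singleton_iff, key]
    constructor
    · intro h
      exact Subtype.ext (h e.1 e.2 rfl rfl)
    · rintro rfl f hf h1 h2
      rw [hinj hf e.2 (Prod.ext h1 h2)]
  have hcard : Fintype.card (Finset.Icc 1 ((key e).1.1 - 1)) = e.1.1 - 1 := by
    simp [key]
  rw [hs, uniformOn_univ, Measure.count_singleton, hcard, one_div, ENNReal.toReal_inv,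
    ENNReal.toReal_natCast, Nat.cast_sub (by omega), Nat.cast_one]

/-- A label conflict makes the event empty, so the product formula survives as an upper bound. This
matters for unions of two copies. -/
lemma measure_subset_chosenEdges_le (F : Finset (ℕ × ℕ × Fin m))
    (hF : (F : Set (ℕ × ℕ × Fin m)) ⊆ E(completeMultigraph m n)) :
    (choiceMeasure m n).real {ω | (F : Set (ℕ × ℕ × Fin m)) ⊆ chosenEdges ω} ≤
      ∏ e ∈ F, ((e.1 : ℝ) - 1)⁻¹ := by
  by_cases hinj : LabelInjective (F : Set (ℕ × ℕ × Fin m))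
  · exact (measure_subset_chosenEdges F hF hinj).le
  · have hempty : {ω : Choices m n | (F : Set (ℕ × ℕ × Fin m)) ⊆ chosenEdges ω} = ∅ := by
      rw [Set.eq_empty_iff_forall_notMem]
      intro ω hω
      refine hinj ?_
      rintro ⟨j, i, a⟩ he ⟨j', i', a'⟩ hf hef
      obtain ⟨rfl, rfl⟩ := Prod.mk.inj hef
      obtain ⟨_, h₁⟩ := hω he
      obtain ⟨_, h₂⟩ := hω hf
      obtain rfl : i = i' := h₁.symm.trans h₂
      rfl
    rw [hempty, measureReal_empty]
    refine Finset.prod_nonneg fun e he => inv_nonneg.2 ?_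
    have := mem_edgeSet_completeMultigraph.1 (hF he)
    have h1 : (1 : ℝ) ≤ e.1 := by exact_mod_cast (by omega : 1 ≤ e.1)
    linarith

lemma finite_copies {α' β' : Type*} (H : Graph α β) (G : Graph α' β') (hV : V(G).Finite)
    (hE : E(G).Finite) : (copies H G).Finite := by
  refine Set.Finite.of_finite_image (f := fun K => (V(K), E(K))) ?_ ?_
  · refine (hV.finite_subsets.prod hE.finite_subsets).subset ?_
    rintro _ ⟨K, hK, rfl⟩
    exact ⟨hK.1.vertexSet_mono, hK.1.edgeSet_mono⟩
  · intro K hK L hL h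
    exact Graph.Compatible.ext (congrArg Prod.fst h) (congrArg Prod.snd h)
      (Graph.Compatible.of_le_le hK.1 hL.1)

lemma finite_vertexSet_completeMultigraph : V(completeMultigraph m n).Finite :=
  Set.finite_Icc 1 n

lemma finite_edgeSet_completeMultigraph : E(completeMultigraph m n).Finite := by
  refine ((Set.finite_Iic n).prod ((Set.finite_Iic n).prod
    (Set.finite_univ (α := Fin m)))).subset fun e he => ?_
  have := mem_edgeSet_completeMultigraph.1 he
  simp only [Set.mem_prod, Set.mem_Iic, Set.mem_univ, and_true]
  omega

lemma finite_copies_completeMultigraph (H : Graph α β) :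
    (copies H (completeMultigraph m n)).Finite :=
  finite_copies _ _ finite_vertexSet_completeMultigraph finite_edgeSet_completeMultigraph

/-- The finite set of copies of `H` in the complete multigraph. -/
noncomputable def completeCopies (H : Graph α β) (m n : ℕ) :
    Finset (Graph ℕ (ℕ × ℕ × Fin m)) :=
  (finite_copies_completeMultigraph (m := m) (n := n) H).toFinset

lemma mem_completeCopies {H : Graph α β} {K : Graph ℕ (ℕ × ℕ × Fin m)} :
    K ∈ completeCopies H m n ↔ K ≤ completeMultigraph m n ∧ Isomorphic K H := by
  simp [completeCopies, copies]

open Classical in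
-- Every outcome contains all `n` vertices, so a copy is present exactly when its edges are chosen;
-- the index set is thus deterministic.
lemma copyCount_eq_sum (H : Graph α β) (ω : Choices m n) :
    copyCount H m n ω = ∑ K ∈ completeCopies H m n,
      {ω | E(K) ⊆ chosenEdges ω}.indicator (fun _ => (1 : ℝ)) ω := by
  have hset : copies H (attachmentGraph m n ω) =
      ((completeCopies H m n).filter fun K => E(K) ⊆ chosenEdges ω : Finset _) := by
    ext K
    simp only [Finset.coe_filter, mem_completeCopies, Set.mem_ofPred_eq, copies]
    constructor
    · rintro ⟨hK, hiso⟩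
      refine ⟨⟨hK.trans Graph.restrict_le, hiso⟩, fun e he => ?_⟩
      obtain ⟨x, y, h⟩ := Graph.exists_isLink_of_mem_edgeSet (hK.edgeSet_mono he)
      exact h.1
    · rintro ⟨⟨hK, hiso⟩, hch⟩
      exact ⟨⟨hK.vertexSet_mono, fun e x y h => ⟨hch h.edge_mem, hK.isLink_mono h⟩⟩, hiso⟩
  rw [copyCount, hset, Set.ncard_coe_finset, Finset.card_filter, Nat.cast_sum]
  refine Finset.sum_congr rfl fun K _ => ?_
  simp [Set.indicator_apply]

lemma integral_copyCount (H : Graph α β) (m n : ℕ) :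
    ∫ ω, copyCount H m n ω ∂(choiceMeasure m n) =
      ∑ K ∈ completeCopies H m n, (choiceMeasure m n).real {ω | E(K) ⊆ chosenEdges ω} := by
  simp_rw [copyCount_eq_sum]
  rw [integral_finsetSum _ fun _ _ => Integrable.of_finite]
  refine Finset.sum_congr rfl fun K _ => ?_
  rw [integral_indicator_const _ (Set.toFinite _).measurableSet, smul_eq_mul, mul_one]

lemma integral_copyCount_sq (H : Graph α β) (m n : ℕ) :
    ∫ ω, copyCount H m n ω ^ 2 ∂(choiceMeasure m n) =
      ∑ K ∈ completeCopies H m n, ∑ L ∈ completeCopies H m n,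
        (choiceMeasure m n).real {ω | E(K) ∪ E(L) ⊆ chosenEdges ω} := by
  simp_rw [copyCount_eq_sum, sq, Finset.sum_mul_sum]
  rw [integral_finsetSum _ fun _ _ => Integrable.of_finite]
  refine Finset.sum_congr rfl fun K _ => ?_
  rw [integral_finsetSum _ fun _ _ => Integrable.of_finite]
  refine Finset.sum_congr rfl fun L _ => ?_
  have hmul : ∀ ω : Choices m n, {ω | E(K) ⊆ chosenEdges ω}.indicator (fun _ => (1 : ℝ)) ω *
      {ω | E(L) ⊆ chosenEdges ω}.indicator (fun _ => (1 : ℝ)) ω =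
      {ω | E(K) ∪ E(L) ⊆ chosenEdges ω}.indicator (fun _ => (1 : ℝ)) ω := by
    intro ω
    by_cases hK : E(K) ⊆ chosenEdges ω <;> by_cases hL : E(L) ⊆ chosenEdges ω <;>
      simp [Set.indicator, Set.union_subset_iff, hK, hL]
  simp_rw [hmul]
  rw [integral_indicator_const _ (Set.toFinite _).measurableSet, smul_eq_mul, mul_one]

lemma memLp_copyCount (H : Graph α β) (m n : ℕ) : MemLp (copyCount H m n) 2 (choiceMeasure m n) :=
  .of_discrete

lemma variance_copyCount_le (H : Graph α β) (m n : ℕ) :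
    variance (copyCount H m n) (choiceMeasure m n) ≤
      ∫ ω, copyCount H m n ω ^ 2 ∂(choiceMeasure m n) :=
  variance_le_expectation_sq (memLp_copyCount H m n).aestronglyMeasurable

/-- Through this inequality the second moment also supplies the upper bound on the mean. -/
lemma sq_integral_copyCount_le (H : Graph α β) (m n : ℕ) :
    (∫ ω, copyCount H m n ω ∂(choiceMeasure m n)) ^ 2 ≤
      ∫ ω, copyCount H m n ω ^ 2 ∂(choiceMeasure m n) := by
  have h := variance_eq_sub (memLp_copyCount H m n)
  have h0 := variance_nonneg (copyCount H m n) (choiceMeasure m n)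
  rw [h] at h0
  simpa using h0

end Probability

/-! ### Transport of expansion along isomorphisms and to unions -/

section Isomorphism

variable {α β α' β' : Type*}

/-- A map of vertices and a map of edges that identify `H` with `K`. -/
structure IsEmbeddingOnto (H : Graph α β) (K : Graph α' β') (p : α → α') (q : β → β') : Prop where
  injOn_vertex : Set.InjOn p V(H)
  injOn_edge : Set.InjOn q E(H)
  image_vertexSet : p '' V(H) = V(K)
  image_edgeSet : q '' E(H) = E(K)
  isLink : ∀ e x y, H.IsLink e x y → K.IsLink (q e) (p x) (p y)

lemma Isomorphic.exists_isEmbeddingOnto {K : Graph α' β'} {H : Graph α β} [Nonempty α']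
    [Nonempty β'] (h : Isomorphic K H) : ∃ p q, IsEmbeddingOnto H K p q := by
  classical
  obtain ⟨f, g, hfg⟩ := h
  let p : α → α' := fun v => if h : v ∈ V(H) then f.symm ⟨v, h⟩ else Classical.arbitrary _
  let q : β → β' := fun e => if h : e ∈ E(H) then g.symm ⟨e, h⟩ else Classical.arbitrary _
  have hp : ∀ v (h : v ∈ V(H)), p v = f.symm ⟨v, h⟩ := fun v h => dif_pos h
  have hq : ∀ v (h : v ∈ E(H)), q v = g.symm ⟨v, h⟩ := fun v h => dif_pos h
  refine ⟨p, q, ⟨?_, ?_, ?_, ?_, ?_⟩⟩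
  · intro x hx y hy hxy
    rw [hp x hx, hp y hy] at hxy
    simpa using Subtype.ext hxy
  · intro x hx y hy hxy
    rw [hq x hx, hq y hy] at hxy
    simpa using Subtype.ext hxy
  · ext v
    constructor
    · rintro ⟨x, hx, rfl⟩
      rw [hp x hx]
      exact Subtype.coe_prop _
    · intro hv
      exact ⟨f ⟨v, hv⟩, Subtype.coe_prop _, by rw [hp _ (Subtype.coe_prop _)]; simp⟩
  · ext e
    constructor
    · rintro ⟨x, hx, rfl⟩
      rw [hq x hx]
      exact Subtype.coe_prop _
    · intro he
      exact ⟨g ⟨e, he⟩, Subtype.coe_prop _, by rw [hq _ (Subtype.coe_prop _)]; simp⟩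
  · intro e x y hl
    rw [hq e hl.edge_mem, hp x hl.left_mem, hp y hl.right_mem, hfg]
    simpa using hl

lemma IsEmbeddingOnto.isomorphic {K : Graph α' β'} {H : Graph α β} {p : α → α'} {q : β → β'}
    (h : IsEmbeddingOnto H K p q) : Isomorphic K H := by
  have hp : Set.BijOn p V(H) V(K) := by
    rw [← h.image_vertexSet]
    exact h.injOn_vertex.bijOn_image
  have hq : Set.BijOn q E(H) E(K) := by
    rw [← h.image_edgeSet]
    exact h.injOn_edge.bijOn_image
  -- Preserving incidence in one direction suffices: the images of the ends of `e` are already the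
  -- ends of `q e`, up to order, and `p` is injective.
  have key : ∀ (e : E(H)) (x y : V(H)), H.IsLink e x y ↔ K.IsLink (q e) (p x) (p y) := by
    intro e x y
    refine ⟨h.isLink _ _ _, fun hl => ?_⟩
    obtain ⟨a, b, hab⟩ := Graph.exists_isLink_of_mem_edgeSet e.2
    rcases (h.isLink _ _ _ hab).eq_and_eq_or_eq_and_eq hl with ⟨h1, h2⟩ | ⟨h1, h2⟩
    · rwa [← h.injOn_vertex hab.left_mem x.2 h1, ← h.injOn_vertex hab.right_mem y.2 h2]
    · rw [← h.injOn_vertex hab.left_mem y.2 h1, ← h.injOn_vertex hab.right_mem x.2 h2]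
      exact hab.symm
  refine ⟨hp.equiv.symm, hq.equiv.symm, fun e x y => ?_⟩
  rw [key]
  have h1 : ∀ x : V(K), p (hp.equiv.symm x) = x := fun x =>
    congrArg Subtype.val (hp.equiv.apply_symm_apply x)
  have h2 : q (hq.equiv.symm e) = e := congrArg Subtype.val (hq.equiv.apply_symm_apply e)
  rw [h1, h1, h2]

/-- Every vertex set `S` of `K` touches at least `|S|` edges, and at least `|S| + 1` edges if it
meets `D`. -/
def Expands (K : Graph α β) (D : Set α) : Prop :=
  ∀ S ⊆ V(K), S.ncard ≤ (touching K S).ncard ∧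
    ((S ∩ D).Nonempty → S.ncard + 1 ≤ (touching K S).ncard)

lemma IsEmbeddingOnto.expands {K : Graph α' β'} {H : Graph α β} {p : α → α'} {q : β → β'}
    (h : IsEmbeddingOnto H K p q) (hE : E(K).Finite) {D : Set α} (hD : D ⊆ V(H))
    (hH : Expands H D) : Expands K (p '' D) := by
  intro S hS
  have hS' : S = p '' (V(H) ∩ p ⁻¹' S) := by
    rw [Set.image_inter_preimage, h.image_vertexSet, Set.inter_eq_right.2 hS]
  have hcard : S.ncard = (V(H) ∩ p ⁻¹' S).ncard := by
    conv_lhs => rw [hS']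
    exact (h.injOn_vertex.mono Set.inter_subset_left).ncard_image
  have htouch : (touching H (V(H) ∩ p ⁻¹' S)).ncard ≤ (touching K S).ncard := by
    rw [← (h.injOn_edge.mono (touching_subset_edgeSet _ _)).ncard_image]
    refine Set.ncard_le_ncard ?_ (hE.subset (touching_subset_edgeSet _ _))
    rintro _ ⟨e, ⟨v, hv, w, hl⟩, rfl⟩
    exact ⟨p v, hv.2, p w, h.isLink _ _ _ hl⟩
  obtain ⟨h1, h2⟩ := hH (V(H) ∩ p ⁻¹' S) Set.inter_subset_left
  refine ⟨by omega, ?_⟩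
  rintro ⟨_, hv, v, hvD, rfl⟩
  have := h2 ⟨v, ⟨hD hvD, hv⟩, hvD⟩
  omega

/-- Split `S` into `S ∩ V(K)`, charged to edges of `K`, and `S \ V(K)`, charged to edges of `L`. No
edge is charged twice, because an edge of `K` has both ends in `V(K)`. The spare edge comes from
`K`. -/
lemma Expands.union_left {K L M : Graph α β} {D : Set α} (hK : K ≤ M)
    (hL : L ≤ M) (hV : V(M).Finite) (hE : E(M).Finite) (hDK : D ⊆ V(K)) (hKe : Expands K D)
    {D' : Set α} (hLe : Expands L D') {S : Set α} (hS : S ⊆ V(K) ∪ V(L)) :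
    S.ncard ≤ (touching K S ∪ touching L S).ncard ∧
      ((S ∩ D).Nonempty → S.ncard + 1 ≤ (touching K S ∪ touching L S).ncard) := by
  have hSf : S.Finite :=
    hV.subset (hS.trans (Set.union_subset hK.vertexSet_mono hL.vertexSet_mono))
  have hfK : (touching K S).Finite :=
    hE.subset ((touching_subset_edgeSet _ _).trans hK.edgeSet_mono)
  have hfL : (touching L S).Finite :=
    hE.subset ((touching_subset_edgeSet _ _).trans hL.edgeSet_mono)
  have hsub : touching K (S ∩ V(K)) ∪ touching L (S \ V(K)) ⊆ touching K S ∪ touching L S :=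
    Set.union_subset_union (touching_mono _ Set.inter_subset_left)
      (touching_mono _ Set.sdiff_subset)
  have hdisj : Disjoint (touching K (S ∩ V(K))) (touching L (S \ V(K))) := by
    rw [Set.disjoint_left]
    rintro e ⟨v, -, hv⟩ ⟨w, hw, hw'⟩
    exact hw.2 ((hK.inc_congr hv.edge_mem).2 (hw'.mono hL)).vertex_mem
  have hle := Set.ncard_le_ncard hsub (hfK.union hfL)
  rw [Set.ncard_union_eq hdisj (hfK.subset (touching_mono _ Set.inter_subset_left))
    (hfL.subset (touching_mono _ Set.sdiff_subset))] at hle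
  have hcard := Set.ncard_inter_add_ncard_sdiff_eq_ncard S V(K) hSf
  obtain ⟨h1, h2⟩ := hKe (S ∩ V(K)) Set.inter_subset_right
  obtain ⟨h3, -⟩ := hLe (S \ V(K)) (Set.sdiff_subset_iff.2 hS)
  refine ⟨by omega, ?_⟩
  rintro ⟨v, hv, hvD⟩
  have := h2 ⟨v, ⟨hv, hDK hvD⟩, hvD⟩
  omega

lemma Expands.union {K L M : Graph α β} {D D' : Set α} (hK : K ≤ M)
    (hL : L ≤ M) (hV : V(M).Finite) (hE : E(M).Finite) (hDK : D ⊆ V(K)) (hDL : D' ⊆ V(L))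
    (hKe : Expands K D) (hLe : Expands L D') {S : Set α} (hS : S ⊆ V(K) ∪ V(L)) :
    S.ncard ≤ (touching K S ∪ touching L S).ncard ∧
      ((S ∩ (D ∪ D')).Nonempty → S.ncard + 1 ≤ (touching K S ∪ touching L S).ncard) := by
  have h1 := hKe.union_left hK hL hV hE hDK hLe hS
  have h2 := hLe.union_left hL hK hV hE hDL hKe (hS.trans (Set.union_comm _ _).subset)
  rw [Set.union_comm] at h2
  refine ⟨h1.1, ?_⟩
  rintro ⟨v, hv, hv' | hv'⟩
  · exact h1.2 ⟨v, hv, hv'⟩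
  · exact h2.2 ⟨v, hv, hv'⟩

end Isomorphism

/-! ### From expansion to products, and the resulting sums over vertex sets -/

section Sums

/-- If every set `S` of vertices touches at least `∑ v ∈ S, c v` edges, then the product of the
larger ends of the edges is at least the product of `v ^ c v` over the vertices. -/
lemma sum_mul_log_le {γ : Type*} (X : Finset ℕ) (F : Finset γ) (hi lo : γ → ℕ) (c : ℕ → ℝ)
    (hX : ∀ v ∈ X, 1 ≤ v) (hF : ∀ e ∈ F, lo e < hi e)
    (h : ∀ S ⊆ X, ∑ v ∈ S, c v ≤ (F.filter fun e => hi e ∈ S ∨ lo e ∈ S).card) :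
    ∑ v ∈ X, c v * Real.log v ≤ ∑ e ∈ F, Real.log (hi e) := by
  classical
  obtain ⟨N, hN⟩ : ∃ N, (∀ v ∈ X, v ≤ N) ∧ ∀ e ∈ F, hi e ≤ N := by
    refine ⟨X.sup id + F.sup hi, fun v hv => ?_, fun e he => ?_⟩
    · exact (Finset.le_sup (f := id) hv).trans (Nat.le_add_right _ _)
    · exact (Finset.le_sup he).trans (Nat.le_add_left _ _)
  -- Layer-cake decomposition: `log v` is the sum of the increments `a j` over `j + 1 < v`.
  set a : ℕ → ℝ := fun j => Real.log ((j + 1 : ℕ) + 1) - Real.log (j + 1) with ha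
  have ha0 : ∀ j, 0 ≤ a j := fun j => by
    refine sub_nonneg.2 (Real.log_le_log (by positivity) ?_)
    push_cast
    linarith
  have hlog : ∀ v, 1 ≤ v → v ≤ N →
      Real.log v = ∑ j ∈ Finset.range N, if j + 1 < v then a j else 0 := by
    intro v hv hvN
    have h1 := Finset.sum_range_sub (fun j : ℕ => Real.log ((j : ℝ) + 1)) (v - 1)
    have h2 : ((v - 1 : ℕ) : ℝ) + 1 = v := by
      rw [Nat.cast_sub hv]
      simp
    rw [h2] at h1
    simp only [Nat.cast_zero, zero_add, Real.log_one, sub_zero] at h1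
    rw [← h1, ← Finset.sum_filter]
    refine Finset.sum_congr ?_ fun j _ => rfl
    ext j
    simp only [Finset.mem_range, Finset.mem_filter]
    omega
  calc ∑ v ∈ X, c v * Real.log v
      = ∑ v ∈ X, ∑ j ∈ Finset.range N, a j * (if j + 1 < v then c v else 0) := by
        refine Finset.sum_congr rfl fun v hv => ?_
        rw [hlog v (hX v hv) (hN.1 v hv), Finset.mul_sum]
        refine Finset.sum_congr rfl fun j _ => ?_
        split_ifs <;> ring
    _ = ∑ j ∈ Finset.range N, a j * ∑ v ∈ X.filter fun v => j + 1 < v, c v := by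
        rw [Finset.sum_comm]
        refine Finset.sum_congr rfl fun j _ => ?_
        rw [← Finset.mul_sum, ← Finset.sum_filter]
    -- The hypothesis is used for the upper level set `{v | j + 1 < v}`: any edge touching it has
    -- its larger end there.
    _ ≤ ∑ j ∈ Finset.range N, a j * (F.filter fun e => j + 1 < hi e).card := by
        refine Finset.sum_le_sum fun j _ => mul_le_mul_of_nonneg_left ?_ (ha0 j)
        refine (h _ (Finset.filter_subset _ _)).trans ?_
        refine Nat.cast_le.2 (Finset.card_le_card fun e => ?_)
        simp only [Finset.mem_filter]
        rintro ⟨he, h1 | h1⟩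
        · exact ⟨he, h1.2⟩
        · exact ⟨he, h1.2.trans (hF e he)⟩
    _ = ∑ j ∈ Finset.range N, ∑ e ∈ F, if j + 1 < hi e then a j else 0 := by
        refine Finset.sum_congr rfl fun j _ => ?_
        rw [← Finset.sum_filter, Finset.sum_const, nsmul_eq_mul, mul_comm]
    _ = ∑ e ∈ F, Real.log (hi e) := by
        rw [Finset.sum_comm]
        refine Finset.sum_congr rfl fun e he => ?_
        have := hF e he
        rw [hlog (hi e) (by omega) (hN.2 e he)]

/-- Give weight `1 + ε` to the vertices of `C` and `1` to those of `A`. The excess `ε * |S ∩ C|` is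
at most `1`, which the spare edge pays for. -/
lemma prod_inv_le_of_expands {γ : Type*} (C A : Finset ℕ) (hCA : Disjoint C A) (F : Finset γ)
    (hi lo : γ → ℕ) (ε : ℝ)
    (hX : ∀ v ∈ C ∪ A, 1 ≤ v) (hF : ∀ e ∈ F, lo e < hi e) (hε : 0 ≤ ε) (hεC : ε * C.card ≤ 1)
    (h : ∀ S ⊆ C ∪ A, S.card ≤ (F.filter fun e => hi e ∈ S ∨ lo e ∈ S).card ∧
      ((S ∩ C).Nonempty → S.card + 1 ≤ (F.filter fun e => hi e ∈ S ∨ lo e ∈ S).card)) :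
    ∏ e ∈ F, ((hi e : ℝ))⁻¹ ≤ (∏ v ∈ C, (v : ℝ) ^ (-(1 + ε))) * ∏ v ∈ A, (v : ℝ)⁻¹ := by
  have key := sum_mul_log_le (C ∪ A) F hi lo (fun v => if v ∈ C then 1 + ε else 1) hX hF (by
    intro S hS
    obtain ⟨h1, h2⟩ := h S hS
    have hsum : ∑ v ∈ S, (if v ∈ C then 1 + ε else 1) = S.card + ε * (S ∩ C).card := by
      have : ∀ v ∈ S, (if v ∈ C then 1 + ε else 1) = 1 + if v ∈ C then ε else 0 := by
        intro v _
        split_ifs <;> simp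
      rw [Finset.sum_congr rfl this, Finset.sum_add_distrib, ← Finset.sum_filter,
        Finset.filter_mem_eq_inter]
      simp [mul_comm]
    rw [hsum]
    by_cases hne : (S ∩ C).Nonempty
    · have h3 : ((S.card + 1 : ℕ) : ℝ) ≤ _ := Nat.cast_le.2 (h2 hne)
      have h4 : ((S ∩ C).card : ℝ) ≤ C.card :=
        Nat.cast_le.2 (Finset.card_le_card Finset.inter_subset_right)
      have h5 := mul_le_mul_of_nonneg_left h4 hε
      push_cast at h3
      linarith
    · rw [Finset.not_nonempty_iff_eq_empty.1 hne]
      simpa using h1)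
  have hpos : ∀ v ∈ C ∪ A, (0 : ℝ) < v := fun v hv => by exact_mod_cast hX v hv
  have hposC : ∀ v ∈ C, (0 : ℝ) < v := fun v hv => hpos v (Finset.mem_union_left _ hv)
  have hposA : ∀ v ∈ A, (0 : ℝ) < v := fun v hv => hpos v (Finset.mem_union_right _ hv)
  have hposF : ∀ e ∈ F, (0 : ℝ) < hi e := fun e he => by
    exact_mod_cast (Nat.zero_le _).trans_lt (hF e he)
  have hR : 0 < (∏ v ∈ C, (v : ℝ) ^ (-(1 + ε))) * ∏ v ∈ A, (v : ℝ)⁻¹ :=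
    mul_pos (Finset.prod_pos fun v hv => Real.rpow_pos_of_pos (hposC v hv) _)
      (Finset.prod_pos fun v hv => inv_pos.2 (hposA v hv))
  rw [← Real.log_le_log_iff (Finset.prod_pos fun e he => inv_pos.2 (hposF e he)) hR,
    Real.log_mul (Finset.prod_pos fun v hv => Real.rpow_pos_of_pos (hposC v hv) _).ne'
      (Finset.prod_pos fun v hv => inv_pos.2 (hposA v hv)).ne',
    Real.log_prod fun e he => (inv_pos.2 (hposF e he)).ne',
    Real.log_prod fun v hv => (Real.rpow_pos_of_pos (hposC v hv) _).ne',
    Real.log_prod fun v hv => (inv_pos.2 (hposA v hv)).ne']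
  rw [Finset.sum_union hCA] at key
  have e1 : ∑ v ∈ C, (if v ∈ C then 1 + ε else 1) * Real.log v =
      - ∑ v ∈ C, Real.log ((v : ℝ) ^ (-(1 + ε))) := by
    rw [← Finset.sum_neg_distrib]
    refine Finset.sum_congr rfl fun v hv => ?_
    rw [if_pos hv, Real.log_rpow (hposC v hv)]
    ring
  have e2 : ∑ v ∈ A, (if v ∈ C then 1 + ε else 1) * Real.log v =
      - ∑ v ∈ A, Real.log ((v : ℝ)⁻¹) := by
    rw [← Finset.sum_neg_distrib]
    refine Finset.sum_congr rfl fun v hv => ?_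
    rw [if_neg (Finset.disjoint_right.1 hCA hv), Real.log_inv]
    ring
  rw [e1, e2] at key
  simp only [Real.log_inv, Finset.sum_neg_distrib] at key ⊢
  linarith

/-- The sum over all subsets is the product of the factors `1 + v^(-(1+ε))`, bounded uniformly in
`n` as the exponents exceed 1. -/
lemma sum_powerset_prod_rpow_le {ε : ℝ} (hε : 0 < ε) (n : ℕ) :
    ∑ C ∈ (Finset.Icc 1 n).powerset, ∏ v ∈ C, (v : ℝ) ^ (-(1 + ε)) ≤
      Real.exp (∑' v : ℕ, (v : ℝ) ^ (-(1 + ε))) := by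
  have hs : Summable fun v : ℕ => (v : ℝ) ^ (-(1 + ε)) :=
    Real.summable_nat_rpow.2 (by linarith)
  rw [← Finset.prod_one_add]
  refine (Real.prod_one_add_le_exp_sum _ fun v => by positivity).trans (Real.exp_le_exp.2 ?_)
  exact hs.sum_le_tsum _ fun v _ => by positivity

/-- Rankin's trick: inserting the factor `L ^ (s - |A|) ≥ 1` removes the size restriction, and the
remaining product of `1 + 1/(vL)` is at most `e`, since the harmonic sum is at most `L`. -/
lemma sum_filter_powerset_prod_inv_le (s n : ℕ) :
    ∑ A ∈ (Finset.Icc 1 n).powerset.filter (fun A => A.card ≤ s), ∏ v ∈ A, (v : ℝ)⁻¹ ≤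
      Real.exp 1 * (1 + Real.log n) ^ s := by
  set L := 1 + Real.log n with hL
  have hL1 : 1 ≤ L := by
    have := Real.log_natCast_nonneg n
    linarith
  have hL0 : 0 < L := by linarith
  have hH : ∑ v ∈ Finset.Icc 1 n, (v : ℝ)⁻¹ ≤ L := by
    have := harmonic_le_one_add_log n
    rw [harmonic_eq_sum_Icc] at this
    push_cast at this
    exact this
  calc ∑ A ∈ (Finset.Icc 1 n).powerset.filter (fun A => A.card ≤ s), ∏ v ∈ A, (v : ℝ)⁻¹
      ≤ ∑ A ∈ (Finset.Icc 1 n).powerset.filter (fun A => A.card ≤ s),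
          L ^ s * ∏ v ∈ A, ((v : ℝ)⁻¹ * L⁻¹) := by
        refine Finset.sum_le_sum fun A hA => ?_
        have hAs : A.card ≤ s := (Finset.mem_filter.1 hA).2
        rw [Finset.prod_mul_distrib, Finset.prod_const]
        have h1 : 1 ≤ L ^ s * L⁻¹ ^ A.card := by
          rw [inv_pow, ← div_eq_mul_inv, one_le_div (by positivity)]
          exact pow_le_pow_right₀ hL1 hAs
        have h2 : 0 ≤ ∏ v ∈ A, (v : ℝ)⁻¹ := Finset.prod_nonneg fun v _ => by positivity
        nlinarith
    _ ≤ ∑ A ∈ (Finset.Icc 1 n).powerset, L ^ s * ∏ v ∈ A, ((v : ℝ)⁻¹ * L⁻¹) :=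
        Finset.sum_le_sum_of_subset_of_nonneg (Finset.filter_subset _ _)
          fun A _ _ => mul_nonneg (by positivity) (Finset.prod_nonneg fun v _ => by positivity)
    _ ≤ L ^ s * Real.exp 1 := by
        rw [← Finset.mul_sum, ← Finset.prod_one_add]
        refine mul_le_mul_of_nonneg_left ?_ (by positivity)
        refine (Real.prod_one_add_le_exp_sum _ fun v => by positivity).trans
          (Real.exp_le_exp.2 ?_)
        rw [← Finset.sum_mul, ← div_eq_mul_inv, div_le_one hL0]
        exact hH
    _ = _ := mul_comm _ _

end Sums

/-! ### Second moment upper bound -/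

section SecondMoment

variable {α β : Type*} {H : Graph α β} {m n : ℕ}

lemma exists_expands_of_mem_completeCopies (hm : 1 ≤ m) {D : Set α} (hD : D ⊆ V(H))
    (hHD : Expands H D) {K : Graph ℕ (ℕ × ℕ × Fin m)} (hK : K ∈ completeCopies H m n) :
    ∃ D' ⊆ V(K), D'.ncard = D.ncard ∧ (V(K) \ D').ncard = (V(H) \ D).ncard ∧
      E(K).ncard = E(H).ncard ∧ Expands K D' := by
  have : NeZero m := ⟨by omega⟩
  obtain ⟨hle, hiso⟩ := mem_completeCopies.1 hK
  obtain ⟨p, q, h⟩ := hiso.exists_isEmbeddingOnto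
  refine ⟨p '' D, ?_, ?_, ?_, ?_, ?_⟩
  · rw [← h.image_vertexSet]
    exact Set.image_mono hD
  · exact (h.injOn_vertex.mono hD).ncard_image
  · rw [← h.image_vertexSet, ← h.injOn_vertex.image_sdiff_subset hD]
    exact (h.injOn_vertex.mono Set.sdiff_subset).ncard_image
  · rw [← h.image_edgeSet, h.injOn_edge.ncard_image]
  · exact h.expands (finite_edgeSet_completeMultigraph.subset hle.edgeSet_mono) hD hHD

lemma isLink_completeMultigraph {e : ℕ × ℕ × Fin m} {x y : ℕ}
    (h : (completeMultigraph m n).IsLink e x y) : x = e.1 ∨ x = e.2.1 :=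
  h.2.imp And.left And.left

lemma isLink_of_le_completeMultigraph {K : Graph ℕ (ℕ × ℕ × Fin m)}
    (hK : K ≤ completeMultigraph m n) {e : ℕ × ℕ × Fin m} (he : e ∈ E(K)) :
    K.IsLink e e.1 e.2.1 := by
  rw [hK.isLink_iff he]
  exact ⟨mem_edgeSet_completeMultigraph.1 (hK.edgeSet_mono he), Or.inl ⟨rfl, rfl⟩⟩

lemma measure_union_subset_chosenEdges_le {K L : Graph ℕ (ℕ × ℕ × Fin m)}
    (hK : K ≤ completeMultigraph m n) (hL : L ≤ completeMultigraph m n) {D D' : Set ℕ}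
    (hD : D ⊆ V(K)) (hD' : D' ⊆ V(L)) (hKe : Expands K D) (hLe : Expands L D') {ε : ℝ}
    (hε : 0 ≤ ε) (C A : Finset ℕ) (hC : (C : Set ℕ) = D ∪ D')
    (hA : (A : Set ℕ) = (V(K) ∪ V(L)) \ (D ∪ D')) (hεC : ε * C.card ≤ 1) :
    (choiceMeasure m n).real {ω | E(K) ∪ E(L) ⊆ chosenEdges ω} ≤
      2 ^ (E(K).ncard + E(L).ncard) *
        ((∏ v ∈ C, (v : ℝ) ^ (-(1 + ε))) * ∏ v ∈ A, (v : ℝ)⁻¹) := by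
  classical
  have hsub : E(K) ∪ E(L) ⊆ E(completeMultigraph m n) :=
    Set.union_subset hK.edgeSet_mono hL.edgeSet_mono
  have hfin : (E(K) ∪ E(L)).Finite := finite_edgeSet_completeMultigraph.subset hsub
  obtain ⟨F, hF⟩ := hfin.exists_finset_coe
  have hCA : ((C ∪ A : Finset ℕ) : Set ℕ) = V(K) ∪ V(L) := by
    rw [Finset.coe_union, hC, hA, Set.union_sdiff_cancel (Set.union_subset_union hD hD')]
  have hF' : ∀ e ∈ F, 1 ≤ e.2.1 ∧ e.2.1 < e.1 ∧ e.1 ≤ n := fun e he =>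
    mem_edgeSet_completeMultigraph.1 (hsub (hF ▸ Finset.mem_coe.2 he))
  have hFcard : F.card ≤ E(K).ncard + E(L).ncard := by
    rw [← Set.ncard_coe_finset, hF]
    exact Set.ncard_union_le _ _
  have hexp : ∏ e ∈ F, ((e.1 : ℝ))⁻¹ ≤
      (∏ v ∈ C, (v : ℝ) ^ (-(1 + ε))) * ∏ v ∈ A, (v : ℝ)⁻¹ := by
    refine prod_inv_le_of_expands C A ?_ F (fun e => e.1) (fun e => e.2.1) ε ?_
      (fun e he => (hF' e he).2.1) hε hεC ?_
    · rw [← Finset.disjoint_coe, hC, hA]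
      exact Set.disjoint_sdiff_right
    · intro v hv
      have hv' : v ∈ V(K) ∪ V(L) := hCA ▸ Finset.mem_coe.2 hv
      have : v ∈ Set.Icc 1 n := hv'.elim (fun h => hK.vertexSet_mono h)
        fun h => hL.vertexSet_mono h
      exact this.1
    · intro S hS
      have hS' : (S : Set ℕ) ⊆ V(K) ∪ V(L) := hCA ▸ Finset.coe_subset.2 hS
      obtain ⟨h1, h2⟩ := Expands.union hK hL finite_vertexSet_completeMultigraph
        finite_edgeSet_completeMultigraph hD hD' hKe hLe hS'
      have htouch : touching K S ∪ touching L S ⊆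
          ((F.filter fun e => e.1 ∈ S ∨ e.2.1 ∈ S : Finset _) : Set (ℕ × ℕ × Fin m)) := by
        have aux : ∀ J : Graph ℕ (ℕ × ℕ × Fin m), J ≤ completeMultigraph m n → E(J) ⊆ F →
            touching J S ⊆
              ((F.filter fun e => e.1 ∈ S ∨ e.2.1 ∈ S : Finset _) : Set (ℕ × ℕ × Fin m)) := by
          rintro J hJ hJF e ⟨v, hv, w, hl⟩
          rw [Finset.coe_filter]
          refine ⟨hJF hl.edge_mem, ?_⟩
          rcases isLink_completeMultigraph (hl.mono hJ) with rfl | rfl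
          · exact Or.inl hv
          · exact Or.inr hv
        exact Set.union_subset (aux K hK (hF ▸ Set.subset_union_left))
          (aux L hL (hF ▸ Set.subset_union_right))
      have hcard := Set.ncard_le_ncard htouch (Finset.finite_toSet _)
      rw [Set.ncard_coe_finset] at hcard
      rw [Set.ncard_coe_finset] at h1 h2
      refine ⟨h1.trans hcard, fun hne => (h2 ?_).trans hcard⟩
      rw [← hC]
      exact_mod_cast hne
  rw [← hF]
  refine (measure_subset_chosenEdges_le F (hF ▸ hsub)).trans ?_
  -- Each larger end `j` is at least 2, so `1/(j-1) ≤ 2/j`; this is the source of the powers of 2.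
  calc ∏ e ∈ F, ((e.1 : ℝ) - 1)⁻¹ ≤ ∏ e ∈ F, (2 * (e.1 : ℝ)⁻¹) := by
        refine Finset.prod_le_prod (fun e he => ?_) fun e he => ?_
        · have h2 : (2 : ℝ) ≤ e.1 := by exact_mod_cast (by have := hF' e he; omega : 2 ≤ e.1)
          exact inv_nonneg.2 (by linarith)
        · have h2 : (2 : ℝ) ≤ e.1 := by exact_mod_cast (by have := hF' e he; omega : 2 ≤ e.1)
          rw [← div_eq_mul_inv, inv_eq_one_div, div_le_div_iff₀ (by linarith) (by linarith)]
          linarith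
    _ = 2 ^ F.card * ∏ e ∈ F, ((e.1 : ℝ))⁻¹ := by
        rw [Finset.prod_mul_distrib, Finset.prod_const]
    _ ≤ _ := by
        refine mul_le_mul (pow_le_pow_right₀ (by norm_num) hFcard) hexp ?_ (by positivity)
        exact Finset.prod_nonneg fun e _ => by positivity

open Classical in
-- A copy is determined by its vertex and edge sets. The point is that the bound does not depend on
-- `n`.
lemma card_filter_completeCopies_le (X : Finset ℕ) :
    ((completeCopies H m n).filter fun K => V(K) ⊆ X).card ≤
      2 ^ X.card * 2 ^ (X.card * (X.card * m)) := by
  have hcard : (X.powerset ×ˢ (X ×ˢ (X ×ˢ (Finset.univ : Finset (Fin m)))).powerset).card =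
      2 ^ X.card * 2 ^ (X.card * (X.card * m)) := by
    simp [Finset.card_product, Finset.card_powerset]
  rw [← hcard]
  have hedge : ∀ K ∈ (completeCopies H m n).filter fun K => V(K) ⊆ X,
      E(K) ⊆ (X ×ˢ (X ×ˢ (Finset.univ : Finset (Fin m))) : Finset _) := by
    intro K hK e he
    rw [Finset.mem_filter, mem_completeCopies] at hK
    have hl := isLink_of_le_completeMultigraph hK.1.1 he
    simp only [Finset.coe_product, Set.mem_prod, Finset.mem_coe, Finset.mem_univ, and_true]
    exact ⟨hK.2 hl.left_mem, hK.2 hl.right_mem⟩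
  refine Finset.card_le_card_of_injOn
    (fun K => (X.filter fun v => v ∈ V(K), (X ×ˢ (X ×ˢ Finset.univ)).filter fun e => e ∈ E(K)))
    (fun K _ => ?_) fun K hK L hL h => ?_
  · simp only [Finset.coe_product, Set.mem_prod, Finset.mem_coe, Finset.mem_powerset]
    exact ⟨Finset.filter_subset _ _, Finset.filter_subset _ _⟩
  · obtain ⟨h1, h2⟩ := Prod.mk.inj h
    have hVK := (Finset.mem_filter.1 hK).2
    have hVL := (Finset.mem_filter.1 hL).2
    have hEK := hedge K hK
    have hEL := hedge L hL
    refine Graph.Compatible.ext ?_ ?_ (Graph.Compatible.of_le_le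
      (mem_completeCopies.1 (Finset.mem_filter.1 hK).1).1
      (mem_completeCopies.1 (Finset.mem_filter.1 hL).1).1)
    · ext v
      have := Finset.ext_iff.1 h1 v
      simp only [Finset.mem_filter] at this
      exact ⟨fun hv => (this.1 ⟨hVK hv, hv⟩).2, fun hv => (this.2 ⟨hVL hv, hv⟩).2⟩
    · ext e
      have := Finset.ext_iff.1 h2 e
      simp only [Finset.mem_filter] at this
      exact ⟨fun he => (this.1 ⟨hEK he, he⟩).2, fun he => (this.2 ⟨hEL he, he⟩).2⟩

lemma exists_integral_copyCount_sq_le (hm : 1 ≤ m) {D : Set α} (hD : D ⊆ V(H))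
    (hHD : Expands H D) : ∃ B : ℝ, 0 ≤ B ∧ ∀ n : ℕ,
      ∫ ω, copyCount H m n ω ^ 2 ∂(choiceMeasure m n) ≤
        B * (1 + Real.log n) ^ (2 * (V(H) \ D).ncard) := by
  classical
  set k := D.ncard with hk
  set t := (V(H) \ D).ncard with ht
  -- Two copies have at most `2k` core vertices in total, so this choice gives `ε * |C| ≤ 1`.
  set ε : ℝ := 1 / (2 * k + 1) with hεdef
  have hε : 0 < ε := by positivity
  set N := 2 * k + 2 * t with hN
  set M : ℕ := 2 ^ N * 2 ^ (N * (N * m)) with hM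
  set Z : ℝ := Real.exp (∑' v : ℕ, (v : ℝ) ^ (-(1 + ε))) with hZ
  refine ⟨2 ^ (E(H).ncard + E(H).ncard) * ((M * M : ℕ) * (Z * Real.exp 1)), by positivity,
    fun n => ?_⟩
  have hex : ∀ K ∈ completeCopies H m n, ∃ D' ⊆ V(K), D'.ncard = D.ncard ∧
      (V(K) \ D').ncard = (V(H) \ D).ncard ∧ E(K).ncard = E(H).ncard ∧ Expands K D' :=
    fun K hK => exists_expands_of_mem_completeCopies hm hD hHD hK
  choose! D' hD'V hD'k hD't hE' hexp using hex
  set 𝒦 := completeCopies H m n with h𝒦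
  -- Pairs of copies are grouped by the union of their cores and the remaining vertices; a vertex in
  -- the core of either copy counts as core. At most `M * M` pairs share these data.
  let φ : Graph ℕ (ℕ × ℕ × Fin m) × Graph ℕ (ℕ × ℕ × Fin m) → Finset ℕ × Finset ℕ := fun P =>
    ((Finset.Icc 1 n).filter fun v => v ∈ D' P.1 ∪ D' P.2,
      (Finset.Icc 1 n).filter fun v => v ∈ (V(P.1) ∪ V(P.2)) \ (D' P.1 ∪ D' P.2))
  have hVsub : ∀ K ∈ 𝒦, V(K) ⊆ Set.Icc 1 n := fun K hK =>
    (mem_completeCopies.1 hK).1.vertexSet_mono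
  have hVfin : ∀ K ∈ 𝒦, V(K).Finite := fun K hK => (Set.finite_Icc 1 n).subset (hVsub K hK)
  have hφ1 : ∀ P ∈ 𝒦 ×ˢ 𝒦, ((φ P).1 : Set ℕ) = D' P.1 ∪ D' P.2 := by
    intro P hP
    obtain ⟨hP1, hP2⟩ := Finset.mem_product.1 hP
    ext v
    simp only [φ, Finset.coe_filter, Finset.mem_Icc]
    refine ⟨fun h => h.2, fun h => ⟨?_, h⟩⟩
    exact h.elim (fun h => hVsub _ hP1 (hD'V _ hP1 h)) fun h => hVsub _ hP2 (hD'V _ hP2 h)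
  have hφ2 : ∀ P ∈ 𝒦 ×ˢ 𝒦,
      ((φ P).2 : Set ℕ) = (V(P.1) ∪ V(P.2)) \ (D' P.1 ∪ D' P.2) := by
    intro P hP
    obtain ⟨hP1, hP2⟩ := Finset.mem_product.1 hP
    ext v
    simp only [φ, Finset.coe_filter, Finset.mem_Icc]
    refine ⟨fun h => h.2, fun h => ⟨?_, h⟩⟩
    exact h.1.elim (fun h => hVsub _ hP1 h) fun h => hVsub _ hP2 h
  have hc1 : ∀ P ∈ 𝒦 ×ˢ 𝒦, (φ P).1.card ≤ 2 * k := by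
    intro P hP
    obtain ⟨hP1, hP2⟩ := Finset.mem_product.1 hP
    rw [← Set.ncard_coe_finset, hφ1 P hP]
    refine (Set.ncard_union_le _ _).trans ?_
    rw [hD'k _ hP1, hD'k _ hP2]
    omega
  have hc2 : ∀ P ∈ 𝒦 ×ˢ 𝒦, (φ P).2.card ≤ 2 * t := by
    intro P hP
    obtain ⟨hP1, hP2⟩ := Finset.mem_product.1 hP
    have hsub : (V(P.1) ∪ V(P.2)) \ (D' P.1 ∪ D' P.2) ⊆
        (V(P.1) \ D' P.1) ∪ (V(P.2) \ D' P.2) := by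
      rintro v ⟨hv | hv, hv'⟩
      · exact Or.inl ⟨hv, fun h => hv' (Or.inl h)⟩
      · exact Or.inr ⟨hv, fun h => hv' (Or.inr h)⟩
    rw [← Set.ncard_coe_finset, hφ2 P hP]
    refine (Set.ncard_le_ncard hsub
      ((hVfin _ hP1).sdiff.union (hVfin _ hP2).sdiff)).trans ?_
    refine (Set.ncard_union_le _ _).trans ?_
    rw [hD't _ hP1, hD't _ hP2]
    omega
  let 𝒯 := (Finset.Icc 1 n).powerset ×ˢ
    (Finset.Icc 1 n).powerset.filter fun A => A.card ≤ 2 * t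
  have hmaps : ∀ P ∈ 𝒦 ×ˢ 𝒦, φ P ∈ 𝒯 := by
    intro P hP
    simp only [𝒯, Finset.mem_product, Finset.mem_powerset, Finset.mem_filter]
    exact ⟨Finset.filter_subset _ _, Finset.filter_subset _ _, hc2 P hP⟩
  let g : Finset ℕ × Finset ℕ → ℝ := fun T =>
    (∏ v ∈ T.1, (v : ℝ) ^ (-(1 + ε))) * ∏ v ∈ T.2, (v : ℝ)⁻¹
  have hg : ∀ T, 0 ≤ g T := fun T =>
    mul_nonneg (Finset.prod_nonneg fun v _ => by positivity)
      (Finset.prod_nonneg fun v _ => by positivity)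
  have hfib : ∀ T ∈ 𝒯, ((𝒦 ×ˢ 𝒦).filter fun P => φ P = T).card ≤ M * M := by
    intro T _
    by_cases hne : ((𝒦 ×ˢ 𝒦).filter fun P => φ P = T).Nonempty
    · obtain ⟨P₀, hmem⟩ := hne
      obtain ⟨hP₀, rfl⟩ := Finset.mem_filter.1 hmem
      set X := (φ P₀).1 ∪ (φ P₀).2 with hX
      have hXN : X.card ≤ N :=
        (Finset.card_union_le _ _).trans (add_le_add (hc1 _ hP₀) (hc2 _ hP₀))
      have hcard : (𝒦.filter fun K => V(K) ⊆ X).card ≤ M := by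
        refine (card_filter_completeCopies_le X).trans ?_
        rw [hM]
        gcongr <;> norm_num
      refine (Finset.card_le_card (t := (𝒦.filter fun K => V(K) ⊆ X) ×ˢ
        (𝒦.filter fun K => V(K) ⊆ X)) fun P hP => ?_).trans ?_
      · obtain ⟨hP, hPT⟩ := Finset.mem_filter.1 hP
        obtain ⟨hP1, hP2⟩ := Finset.mem_product.1 hP
        have hXeq : (X : Set ℕ) = V(P.1) ∪ V(P.2) := by
          rw [hX, ← hPT, Finset.coe_union, hφ1 P hP, hφ2 P hP,
            Set.union_sdiff_cancel (Set.union_subset_union (hD'V _ hP1) (hD'V _ hP2))]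
        simp only [Finset.mem_product, Finset.mem_filter, hXeq]
        exact ⟨⟨hP1, Set.subset_union_left⟩, hP2, Set.subset_union_right⟩
      · rw [Finset.card_product]
        exact Nat.mul_le_mul hcard hcard
    · rw [Finset.not_nonempty_iff_eq_empty.1 hne]
      simp
  have hpair : ∀ P ∈ 𝒦 ×ˢ 𝒦,
      (choiceMeasure m n).real {ω | E(P.1) ∪ E(P.2) ⊆ chosenEdges ω} ≤
        2 ^ (E(H).ncard + E(H).ncard) * g (φ P) := by
    intro P hP
    obtain ⟨hP1, hP2⟩ := Finset.mem_product.1 hP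
    have h := measure_union_subset_chosenEdges_le (mem_completeCopies.1 hP1).1
      (mem_completeCopies.1 hP2).1 (hD'V _ hP1) (hD'V _ hP2) (hexp _ hP1) (hexp _ hP2) hε.le
      (φ P).1 (φ P).2 (hφ1 P hP) (hφ2 P hP) (by
        have : ((φ P).1.card : ℝ) ≤ 2 * k := by exact_mod_cast hc1 P hP
        rw [hεdef, one_div, inv_mul_le_iff₀ (by positivity)]
        linarith)
    rwa [hE' _ hP1, hE' _ hP2] at h
  rw [integral_copyCount_sq, ← Finset.sum_product']
  calc ∑ P ∈ 𝒦 ×ˢ 𝒦, (choiceMeasure m n).real {ω | E(P.1) ∪ E(P.2) ⊆ chosenEdges ω}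
      ≤ ∑ P ∈ 𝒦 ×ˢ 𝒦, 2 ^ (E(H).ncard + E(H).ncard) * g (φ P) := Finset.sum_le_sum hpair
    _ = 2 ^ (E(H).ncard + E(H).ncard) *
          ∑ T ∈ 𝒯, ∑ P ∈ (𝒦 ×ˢ 𝒦).filter (fun P => φ P = T), g (φ P) := by
        rw [← Finset.mul_sum, Finset.sum_fiberwise_of_maps_to hmaps]
    _ ≤ 2 ^ (E(H).ncard + E(H).ncard) * ∑ T ∈ 𝒯, (M * M : ℕ) * g T := by
        refine mul_le_mul_of_nonneg_left (Finset.sum_le_sum fun T hT => ?_) (by positivity)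
        rw [Finset.sum_congr rfl fun P hP => by rw [(Finset.mem_filter.1 hP).2],
          Finset.sum_const, nsmul_eq_mul]
        exact mul_le_mul_of_nonneg_right (Nat.cast_le.2 (hfib T hT)) (hg T)
    _ ≤ 2 ^ (E(H).ncard + E(H).ncard) *
          ((M * M : ℕ) * (Z * (Real.exp 1 * (1 + Real.log n) ^ (2 * t)))) := by
        rw [← Finset.mul_sum]
        refine mul_le_mul_of_nonneg_left (mul_le_mul_of_nonneg_left ?_ (by positivity))
          (by positivity)
        simp only [𝒯, g, Finset.sum_product]
        rw [← Finset.sum_mul_sum]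
        refine mul_le_mul (sum_powerset_prod_rpow_le hε n)
          (sum_filter_powerset_prod_inv_le (2 * t) n) ?_ (by positivity)
        exact Finset.sum_nonneg fun A _ => Finset.prod_nonneg fun v _ => by positivity
    _ = _ := by ring

end SecondMoment

/-! ### Potential copies from placements and labellings -/

section Construction

variable {α β : Type*} {H : Graph α β} {m n : ℕ}

/-- An injective placement of the vertices in `{1, …, n}` and a labelling of the edges, such that
edges with the same larger end have different labels, give a potential copy. -/
lemma exists_copy_of_labelling [H.Loopless] (p : α → ℕ) (hp : Set.InjOn p V(H))
    (hpV : ∀ v ∈ V(H), 1 ≤ p v ∧ p v ≤ n) (lab : β → Fin m)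
    (hlab : ∀ e f x y x' y', H.IsLink e x y → H.IsLink f x' y' → p y < p x → p y' < p x' →
      p x = p x' → lab e = lab f → e = f) :
    ∃ K ∈ completeCopies H m n, ∃ q : β → ℕ × ℕ × Fin m, V(K) = p '' V(H) ∧
      E(K) = q '' E(H) ∧ Set.InjOn q E(H) ∧ LabelInjective E(K) ∧
      ∀ e x y, H.IsLink e x y → p y < p x → q e = (p x, p y, lab e) := by
  have hends : ∀ e ∈ E(H), ∃ x y, H.IsLink e x y ∧ p y < p x := by
    intro e he
    obtain ⟨x, y, h⟩ := Graph.exists_isLink_of_mem_edgeSet he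
    rcases lt_trichotomy (p x) (p y) with hlt | heq | hlt
    · exact ⟨y, x, h.symm, hlt⟩
    · exact absurd (hp h.left_mem h.right_mem heq) h.ne
    · exact ⟨x, y, h, hlt⟩
  -- An edge goes to the triple of its larger end, smaller end and label. For `e` outside `E(H)` the
  -- condition is vacuous and any value serves.
  have hq : ∀ e, ∃ t : ℕ × ℕ × Fin m, ∀ x y, H.IsLink e x y → p y < p x →
      t = (p x, p y, lab e) := by
    intro e
    by_cases he : e ∈ E(H)
    · obtain ⟨x, y, h, hlt⟩ := hends e he
      refine ⟨(p x, p y, lab e), fun x' y' h' hlt' => ?_⟩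
      rcases h.eq_and_eq_or_eq_and_eq h' with ⟨rfl, rfl⟩ | ⟨rfl, rfl⟩
      · rfl
      · omega
    · exact ⟨(0, 0, lab e), fun x y h _ => absurd h.edge_mem he⟩
  choose q hq using hq
  have hkey : ∀ e ∈ E(H), ∀ f ∈ E(H), (q e).1 = (q f).1 → (q e).2.2 = (q f).2.2 → e = f := by
    intro e he f hf h1 h2
    obtain ⟨x, y, h, hlt⟩ := hends e he
    obtain ⟨x', y', h', hlt'⟩ := hends f hf
    rw [hq e x y h hlt, hq f x' y' h' hlt'] at h1 h2
    exact hlab e f x y x' y' h h' hlt hlt' h1 h2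
  have hqinj : Set.InjOn q E(H) := fun e he f hf h => hkey e he f hf (by rw [h]) (by rw [h])
  have hlink : ∀ e x y, H.IsLink e x y → (completeMultigraph m n).IsLink (q e) (p x) (p y) := by
    have aux : ∀ e x y, H.IsLink e x y → p y < p x →
        (completeMultigraph m n).IsLink (q e) (p x) (p y) := by
      intro e x y h hlt
      rw [hq e x y h hlt]
      exact ⟨⟨(hpV y h.right_mem).1, hlt, (hpV x h.left_mem).2⟩, Or.inl ⟨rfl, rfl⟩⟩
    intro e x y h
    rcases lt_trichotomy (p x) (p y) with hlt | heq | hlt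
    · exact (aux e y x h.symm hlt).symm
    · exact absurd (hp h.left_mem h.right_mem heq) h.ne
    · exact aux e x y h hlt
  let K : Graph ℕ (ℕ × ℕ × Fin m) := ((completeMultigraph m n).restrict (q '' E(H))).induce
    (p '' V(H))
  have hKlink : ∀ e x y, H.IsLink e x y → K.IsLink (q e) (p x) (p y) := fun e x y h =>
    ⟨⟨⟨e, h.edge_mem, rfl⟩, hlink e x y h⟩, ⟨x, h.left_mem, rfl⟩, ⟨y, h.right_mem, rfl⟩⟩
  have hKle : K ≤ completeMultigraph m n := by
    refine ⟨?_, fun e x y h => h.1.2⟩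
    rintro _ ⟨v, hv, rfl⟩
    exact hpV v hv
  have hKE : E(K) = q '' E(H) := by
    ext e
    constructor
    · intro he
      obtain ⟨x, y, h⟩ := Graph.exists_isLink_of_mem_edgeSet he
      exact h.1.1
    · rintro ⟨e, he, rfl⟩
      obtain ⟨x, y, h⟩ := Graph.exists_isLink_of_mem_edgeSet he
      exact (hKlink e x y h).edge_mem
  have hemb : IsEmbeddingOnto H K p q := ⟨hp, hqinj, rfl, hKE.symm, hKlink⟩
  refine ⟨K, mem_completeCopies.2 ⟨hKle, hemb.isomorphic⟩, q, rfl, hKE, hqinj, ?_, hq⟩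
  rw [hKE]
  rintro _ ⟨e, he, rfl⟩ _ ⟨f, hf, rfl⟩ hef
  rw [hkey e he f hf (Prod.mk.inj hef).1 (Prod.mk.inj hef).2]

/-- Giving all edges different labels avoids every conflict. Hence the infimum defining `minLabels`
is over a nonempty set and is attained. -/
lemma exists_potentialCopies_nonempty (hV : V(H).Finite) (hE : E(H).Finite) [H.Loopless] :
    ∃ m, 1 ≤ m ∧ ∃ n, (potentialCopies H m n).Nonempty := by
  obtain ⟨p, hp⟩ := Set.countable_iff_exists_injOn.1 hV.countable
  obtain ⟨l, hl⟩ := Set.countable_iff_exists_injOn.1 hE.countable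
  obtain ⟨n, hn⟩ := (hV.image p).bddAbove
  obtain ⟨m, hm⟩ := (hE.image l).bddAbove
  refine ⟨m + 1, by omega, n + 1, ?_⟩
  obtain ⟨K, hK, q, -, -, -, hinj, -⟩ := exists_copy_of_labelling (H := H) (m := m + 1) (n := n + 1)
    (fun v => p v + 1) (fun x hx y hy h => hp hx hy (Nat.succ_injective h))
    (fun v hv => ⟨by omega, Nat.succ_le_succ (hn ⟨v, hv, rfl⟩)⟩) (fun e => Fin.ofNat (m + 1) (l e))
    (by
      intro e f x y x' y' h h' _ _ _ heq
      have he := hm ⟨e, h.edge_mem, rfl⟩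
      have hf := hm ⟨f, h'.edge_mem, rfl⟩
      have := congrArg Fin.val heq
      simp only [Fin.val_ofNat] at this
      rw [Nat.mod_eq_of_lt (by omega), Nat.mod_eq_of_lt (by omega)] at this
      exact hl h.edge_mem h'.edge_mem this)
  exact ⟨K, mem_completeCopies.1 hK, fun e he f hf h1 h2 => hinj he hf (Prod.ext h1 h2)⟩

/-- For `m ≥ m_H` there are a placement of the vertices and a labelling of the edges that describe a
potential copy. -/
lemma exists_labelling_of_minLabels_le (hV : V(H).Finite) (hE : E(H).Finite) [H.Loopless]
    (hm : minLabels H ≤ m) : ∃ (n : ℕ) (p : α → ℕ) (lab : β → Fin m), Set.InjOn p V(H) ∧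
      (∀ v ∈ V(H), 1 ≤ p v ∧ p v ≤ n) ∧
      ∀ e f x y x' y', H.IsLink e x y → H.IsLink f x' y' → p y < p x → p y' < p x' →
        p x = p x' → lab e = lab f → e = f := by
  have hmem : 1 ≤ minLabels H ∧ ∃ n, (potentialCopies H (minLabels H) n).Nonempty :=
    Nat.sInf_mem (exists_potentialCopies_nonempty hV hE)
  obtain ⟨hm₀, n, K, ⟨hle, hiso⟩, hK⟩ := hmem
  have : NeZero (minLabels H) := ⟨by omega⟩
  obtain ⟨p, q, h⟩ := hiso.exists_isEmbeddingOnto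
  have hends : ∀ e x y, H.IsLink e x y → p y < p x → (q e).1 = p x := by
    intro e x y hl hlt
    obtain ⟨⟨-, h1, -⟩, h2⟩ := hle.isLink_mono (h.isLink e x y hl)
    omega
  -- A labelling with `minLabels H` labels is also one with `m` labels.
  refine ⟨n, p, fun e => Fin.castLE hm (q e).2.2, h.injOn_vertex, fun v hv => ?_, ?_⟩
  · exact hle.vertexSet_mono (h.image_vertexSet ▸ Set.mem_image_of_mem p hv)
  · intro e f x y x' y' hl hl' hlt hlt' htop hlabel
    have he : q e ∈ E(K) := h.image_edgeSet ▸ Set.mem_image_of_mem q hl.edge_mem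
    have hf : q f ∈ E(K) := h.image_edgeSet ▸ Set.mem_image_of_mem q hl'.edge_mem
    refine h.injOn_edge hl.edge_mem hl'.edge_mem (hK _ he _ hf ?_ (Fin.castLE_injective hm hlabel))
    rw [hends e x y hl hlt, hends f x' y' hl' hlt', htop]

end Construction

/-! ### Lower bound on the mean by block placements -/

section LowerBound

variable {α β : Type*} {H : Graph α β} {m : ℕ}

lemma log_sub_log_le_sum_Ioc {N M : ℕ} (hN : 1 ≤ N) (hNM : N ≤ M) :
    Real.log M - Real.log N ≤ ∑ x ∈ Finset.Ioc N M, ((x : ℝ) - 1)⁻¹ := by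
  induction M, hNM using Nat.le_induction with
  | base => simp
  | succ M hM ih =>
    have hM0 : (0 : ℝ) < M := by exact_mod_cast hN.trans hM
    have h := Real.log_le_sub_one_of_pos (show (0 : ℝ) < (M + 1 : ℕ) / M by positivity)
    rw [Real.log_div (by positivity) hM0.ne', div_sub_one hM0.ne'] at h
    have h1 : (((M + 1 : ℕ) : ℝ) - M) / M = (((M + 1 : ℕ) : ℝ) - 1)⁻¹ := by
      push_cast
      simp
    rw [Finset.sum_Ioc_succ_top hM]
    linarith

/-- Blocks whose ends have ratio `b` carry weight at least `log b` wherever they start. -/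
lemma log_le_sum_block {N b : ℕ} (hN : 1 ≤ N) (hb : 1 ≤ b) :
    Real.log b ≤ ∑ x ∈ Finset.Ioc N (N * b), ((x : ℝ) - 1)⁻¹ := by
  have h := log_sub_log_le_sum_Ioc hN (Nat.le_mul_of_pos_right N hb)
  rw [Nat.cast_mul, Real.log_mul (by positivity) (by positivity)] at h
  linarith

/-- The vertices outside the `2`-core placed in blocks according to their rank. -/
lemma exists_copy_of_block_placement (hV : V(H).Finite) (hE : E(H).Finite) [H.Loopless]
    (hm : 1 ≤ m) {n₀ : ℕ} {p₀ : α → ℕ} {lab : β → Fin m} (hn₀ : 1 ≤ n₀)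
    (hp₀ : Set.InjOn p₀ V(H)) (hp₀V : ∀ v ∈ V(H), 1 ≤ p₀ v ∧ p₀ v ≤ n₀)
    (hlab : ∀ e f x y x' y', H.IsLink e x y → H.IsLink f x' y' → p₀ y < p₀ x → p₀ y' < p₀ x' →
        p₀ x = p₀ x' → lab e = lab f → e = f)
    {t : ℕ} {r : α → ℕ} {top : β → α} (hr₀ : ∀ v ∈ V(twoCore H), r v = 0)
    (hr : ∀ v ∈ V(H) \ V(twoCore H), 1 ≤ r v ∧ r v ≤ t)
    (hrinj : Set.InjOn r (V(H) \ V(twoCore H)))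
    (htop : ∀ e ∈ E(H) \ E(twoCore H), top e ∈ V(H) \ V(twoCore H) ∧
        ∃ u, H.IsLink e (top e) u ∧ r u < r (top e))
    (htopinj : Set.InjOn top (E(H) \ E(twoCore H)))
    {b n : ℕ} (hb : 1 ≤ b) (hn : n₀ * b ^ t ≤ n) (y : α → ℕ)
    (hy : ∀ v ∈ V(H) \ V(twoCore H), y v ∈ Finset.Ioc (n₀ * b ^ (r v - 1)) (n₀ * b ^ (r v))) :
    ∃ K ∈ completeCopies H m n,
      V(K) = p₀ '' V(twoCore H) ∪ y '' (V(H) \ V(twoCore H)) ∧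
      ((n₀ : ℝ)⁻¹) ^ E(H).ncard * ∏ v ∈ (hV.sdiff (t := V(twoCore H))).toFinset, ((y v : ℝ) - 1)⁻¹ ≤
        (choiceMeasure m n).real {ω | E(K) ⊆ chosenEdges ω} := by
  classical
  have : NeZero m := ⟨by omega⟩
  set C := V(twoCore H) with hC
  have hCV : C ⊆ V(H) := (twoCore_le H).vertexSet_mono
  have hmono : ∀ {i j : ℕ}, i ≤ j → n₀ * b ^ i ≤ n₀ * b ^ j := fun h =>
    Nat.mul_le_mul_left _ (Nat.pow_le_pow_right hb h)
  have hyle : ∀ v ∈ V(H) \ C, y v ≤ n₀ * b ^ r v := fun v hv => (Finset.mem_Ioc.1 (hy v hv)).2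
  have hylt : ∀ v ∈ V(H) \ C, ∀ i < r v, n₀ * b ^ i < y v := fun v hv i hi =>
    (hmono (by omega)).trans_lt (Finset.mem_Ioc.1 (hy v hv)).1
  have hyn₀ : ∀ v ∈ V(H) \ C, n₀ < y v := fun v hv => by
    simpa using hylt v hv 0 (hr v hv).1
  let p : α → ℕ := fun v => if v ∈ C then p₀ v else y v
  have hpC : ∀ v ∈ C, p v = p₀ v := fun v hv => if_pos hv
  have hpA : ∀ v ∈ V(H) \ C, p v = y v := fun v hv => if_neg hv.2
  have hpCn₀ : ∀ v ∈ C, p v ≤ n₀ := fun v hv => hpC v hv ▸ (hp₀V v (hCV hv)).2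
  have hple : ∀ v ∈ V(H), p v ≤ n₀ * b ^ r v := by
    intro v hv
    by_cases hvC : v ∈ C
    · exact (hpCn₀ v hvC).trans (Nat.le_mul_of_pos_right _ (Nat.pow_pos hb))
    · rw [hpA v ⟨hv, hvC⟩]
      exact hyle v ⟨hv, hvC⟩
  -- Blocks increase with rank and lie beyond `n₀`, so rank order forces position order; hence the
  -- larger end of a tree edge is its `top`.
  have hplt : ∀ u ∈ V(H), ∀ v ∈ V(H) \ C, r u < r v → p u < p v := by
    intro u hu v hv huv
    rw [hpA v hv]
    exact (hple u hu).trans_lt (hylt v hv _ huv)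
  have hr0 : ∀ v ∈ V(H), v ∈ C ∨ v ∈ V(H) \ C := fun v hv =>
    (em (v ∈ C)).imp id fun h => ⟨hv, h⟩
  have hpinj : Set.InjOn p V(H) := by
    intro u hu v hv huv
    rcases hr0 u hu with huC | huA <;> rcases hr0 v hv with hvC | hvA
    · rw [hpC u huC, hpC v hvC] at huv
      exact hp₀ hu hv huv
    · have := hplt u hu v hvA (by rw [hr₀ u huC]; exact (hr v hvA).1)
      omega
    · have := hplt v hv u huA (by rw [hr₀ v hvC]; exact (hr u huA).1)
      omega
    · rcases lt_trichotomy (r u) (r v) with h | h | h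
      · have := hplt u hu v hvA h
        omega
      · exact hrinj huA hvA h
      · have := hplt v hv u huA h
        omega
  have hpV : ∀ v ∈ V(H), 1 ≤ p v ∧ p v ≤ n := by
    intro v hv
    rcases hr0 v hv with hvC | hvA
    · rw [hpC v hvC]
      have h1 := hp₀V v hv
      have h2 : n₀ ≤ n₀ * b ^ t := Nat.le_mul_of_pos_right _ (Nat.pow_pos hb)
      omega
    · have h1 := hyn₀ v hvA
      have h2 := hple v hv
      have h3 := hmono (hr v hvA).2
      rw [hpA v hvA] at h2 ⊢
      omega
  -- Label `0` serves all tree edges: their larger ends are pairwise distinct and exceed `n₀`, so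
  -- they clash neither with each other nor with core edges.
  let lab' : β → Fin m := fun e => if e ∈ E(twoCore H) then lab e else 0
  have hcore : ∀ e x z, e ∈ E(twoCore H) → H.IsLink e x z → x ∈ C ∧ z ∈ C := by
    intro e x z he h
    have h' := ((twoCore_le H).isLink_iff he).2 h
    exact ⟨h'.left_mem, h'.right_mem⟩
  have htree : ∀ e x z, e ∉ E(twoCore H) → H.IsLink e x z → p z < p x →
      x = top e ∧ x ∈ V(H) \ C := by
    intro e x z he h hlt
    obtain ⟨hA, u, hu, hur⟩ := htop e ⟨h.edge_mem, he⟩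
    rcases h.eq_and_eq_or_eq_and_eq hu with ⟨rfl, rfl⟩ | ⟨rfl, rfl⟩
    · exact ⟨rfl, hA⟩
    · have := hplt x h.left_mem _ hA hur
      omega
  obtain ⟨K, hK, q, hVK, hEK, hqinj, hKinj, hq⟩ := exists_copy_of_labelling (n := n) p hpinj hpV
    lab' (by
      intro e f x z x' z' h h' hlt hlt' hx hl
      by_cases he : e ∈ E(twoCore H) <;> by_cases hf : f ∈ E(twoCore H)
      · obtain ⟨h1, h2⟩ := hcore e x z he h
        obtain ⟨h3, h4⟩ := hcore f x' z' hf h'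
        simp only [lab', if_pos he, if_pos hf] at hl
        rw [hpC _ h1, hpC _ h2] at hlt
        rw [hpC _ h3, hpC _ h4] at hlt'
        rw [hpC _ h1, hpC _ h3] at hx
        exact hlab e f x z x' z' h h' hlt hlt' hx hl
      · have h1 := hpCn₀ x (hcore e x z he h).1
        have h2 := (htree f x' z' hf h' hlt').2
        have h3 := hyn₀ x' h2
        rw [hx, hpA x' h2] at h1
        omega
      · have h1 := hpCn₀ x' (hcore f x' z' hf h').1
        have h2 := (htree e x z he h hlt).2
        have h3 := hyn₀ x h2
        rw [← hx, hpA x h2] at h1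
        omega
      · have h1 := (htree e x z he h hlt).1
        have h2 := (htree f x' z' hf h' hlt').1
        refine htopinj ⟨h.edge_mem, he⟩ ⟨h'.edge_mem, hf⟩ ?_
        rw [← h1, ← h2]
        exact hpinj h.left_mem h'.left_mem hx)
  refine ⟨K, hK, ?_, ?_⟩
  · rw [hVK]
    conv_lhs => rw [← Set.union_sdiff_cancel hCV, Set.image_union]
    rw [Set.image_congr hpC, Set.image_congr hpA]
  obtain ⟨hKle, -⟩ := mem_completeCopies.1 hK
  have hEK' : ((hE.toFinset.image q : Finset _) : Set (ℕ × ℕ × Fin m)) = E(K) := by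
    rw [Finset.coe_image, Set.Finite.coe_toFinset, hEK]
  have hprob := measure_subset_chosenEdges (n := n) (hE.toFinset.image q)
    (hEK' ▸ hKle.edgeSet_mono) (hEK' ▸ hKinj)
  rw [hEK'] at hprob
  rw [hprob, Finset.prod_image (by simpa using hqinj)]
  set EH := hE.toFinset
  set A := (hV.sdiff (t := C)).toFinset
  have hmemA : ∀ v, v ∈ A ↔ v ∈ V(H) \ C := fun v => by simp [A]
  have hmemE : ∀ e, e ∈ EH ↔ e ∈ E(H) := fun e => by simp [EH]
  have hends : ∀ e ∈ E(H), ∃ x z, H.IsLink e x z ∧ p z < p x := by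
    intro e he
    obtain ⟨x, z, h⟩ := Graph.exists_isLink_of_mem_edgeSet he
    rcases lt_trichotomy (p x) (p z) with hlt | heq | hlt
    · exact ⟨z, x, h.symm, hlt⟩
    · exact absurd (hpinj h.left_mem h.right_mem heq) h.ne
    · exact ⟨x, z, h, hlt⟩
  have hn₀0 : (0 : ℝ) < n₀ := by exact_mod_cast hn₀
  have hfac : ∀ v ∈ A, 0 ≤ ((y v : ℝ) - 1)⁻¹ ∧ ((y v : ℝ) - 1)⁻¹ ≤ 1 := by
    intro v hv
    have h2 : (2 : ℝ) ≤ y v := by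
      exact_mod_cast (by have := hyn₀ v ((hmemA v).1 hv); omega : 2 ≤ y v)
    exact ⟨inv_nonneg.2 (by linarith), inv_le_one_of_one_le₀ (by linarith)⟩
  rw [← Finset.prod_filter_mul_prod_filter_not EH (fun e => e ∈ E(twoCore H))]
  refine mul_le_mul ?_ ?_ (Finset.prod_nonneg fun v hv => (hfac v hv).1) ?_
  -- Core edges have larger end at most `n₀`, so each contributes at least `1/n₀`.
  · have hcard : (EH.filter fun e => e ∈ E(twoCore H)).card ≤ E(H).ncard := by
      rw [Set.ncard_eq_toFinset_card _ hE]
      exact Finset.card_le_card (Finset.filter_subset _ _)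
    calc ((n₀ : ℝ)⁻¹) ^ E(H).ncard
        ≤ ((n₀ : ℝ)⁻¹) ^ (EH.filter fun e => e ∈ E(twoCore H)).card :=
          pow_le_pow_of_le_one (by positivity)
            (inv_le_one_of_one_le₀ (by exact_mod_cast hn₀)) hcard
      _ = ∏ e ∈ EH.filter (fun e => e ∈ E(twoCore H)), (n₀ : ℝ)⁻¹ := by rw [Finset.prod_const]
      _ ≤ _ := by
          refine Finset.prod_le_prod (fun _ _ => by positivity) fun e he => ?_
          obtain ⟨he, heC⟩ := Finset.mem_filter.1 he
          obtain ⟨x, z, h, hlt⟩ := hends e ((hmemE e).1 he)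
          rw [hq e x z h hlt]
          have h1 := hpCn₀ x (hcore e x z heC h).1
          have h2 := hpV z h.right_mem
          have h3 : (2 : ℝ) ≤ p x := by exact_mod_cast (by omega : 2 ≤ p x)
          have h4 : (p x : ℝ) ≤ n₀ := by exact_mod_cast h1
          exact inv_anti₀ (by linarith) (by linarith)
  · have htopval : ∀ e ∈ EH.filter (fun e => e ∉ E(twoCore H)),
        (((q e).1 : ℝ) - 1)⁻¹ = ((y (top e) : ℝ) - 1)⁻¹ := by
      intro e he
      obtain ⟨he, heC⟩ := Finset.mem_filter.1 he
      obtain ⟨x, z, h, hlt⟩ := hends e ((hmemE e).1 he)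
      obtain ⟨h1, h2⟩ := htree e x z heC h hlt
      rw [hq e x z h hlt, ← h1, hpA x h2]
    have hsub : (EH.filter fun e => e ∉ E(twoCore H)).image top ⊆ A := by
      intro v hv
      obtain ⟨e, he, rfl⟩ := Finset.mem_image.1 hv
      obtain ⟨he, heC⟩ := Finset.mem_filter.1 he
      exact (hmemA _).2 (htop e ⟨(hmemE e).1 he, heC⟩).1
    -- Tree edges contribute the factors of their tops. Any other factor over `A` is at most 1, so
    -- injectivity of `top` suffices.
    rw [Finset.prod_congr rfl htopval,
      ← Finset.prod_image (f := fun v => ((y v : ℝ) - 1)⁻¹) (g := top) (by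
        intro e he f hf h
        simp only [Finset.coe_filter, Set.mem_ofPred_eq, hmemE] at he hf
        exact htopinj he hf h), ← Finset.prod_sdiff hsub]
    refine mul_le_of_le_one_left (Finset.prod_nonneg fun v hv => (hfac v (hsub hv)).1) ?_
    exact Finset.prod_le_one (fun v hv => (hfac v (Finset.sdiff_subset hv)).1)
      fun v hv => (hfac v (Finset.sdiff_subset hv)).2
  · refine Finset.prod_nonneg fun e he => ?_
    obtain ⟨he, -⟩ := Finset.mem_filter.1 he
    obtain ⟨x, z, h, hlt⟩ := hends e ((hmemE e).1 he)
    rw [hq e x z h hlt]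
    have h3 : (1 : ℝ) ≤ p x := by exact_mod_cast (hpV x h.left_mem).1
    exact inv_nonneg.2 (by linarith)

lemma exists_log_pow_le_integral_copyCount (hV : V(H).Finite) (hE : E(H).Finite)
    (hne : V(H).Nonempty) [H.Loopless] (hm : 1 ≤ m) (hmH : minLabels H ≤ m) :
    ∃ n₀ : ℕ, 1 ≤ n₀ ∧ ∀ b n : ℕ, 1 ≤ b → n₀ * b ^ (V(H) \ V(twoCore H)).ncard ≤ n →
      ((n₀ : ℝ)⁻¹) ^ E(H).ncard * Real.log b ^ (V(H) \ V(twoCore H)).ncard ≤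
        ∫ ω, copyCount H m n ω ∂(choiceMeasure m n) := by
  classical
  obtain ⟨n₀, p₀, lab, hp₀, hp₀V, hlab⟩ := exists_labelling_of_minLabels_le hV hE hmH
  obtain ⟨r, top, hr₀, hr, hrinj, htop, htopinj⟩ := exists_elimination_rank hV hne
  set C := V(twoCore H) with hC
  have hCV : C ⊆ V(H) := (twoCore_le H).vertexSet_mono
  have hn₀ : 1 ≤ n₀ := by
    obtain ⟨v, hv⟩ := hne
    exact (hp₀V v hv).1.trans (hp₀V v hv).2
  refine ⟨n₀, hn₀, fun b n hb hn => ?_⟩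
  set A := (hV.sdiff (t := C)).toFinset with hA
  have hmemA : ∀ v, v ∈ A ↔ v ∈ V(H) \ C := fun v => by simp [A]
  let blocks : ∀ v : A, Finset ℕ := fun v => Finset.Ioc (n₀ * b ^ (r v - 1)) (n₀ * b ^ (r v))
  let ext : (A → ℕ) → α → ℕ := fun y v => if h : v ∈ A then y ⟨v, h⟩ else 0
  have hext : ∀ y (v : A), ext y v = y v := fun y v => dif_pos v.2
  have hex : ∀ y ∈ Fintype.piFinset blocks, ∃ K ∈ completeCopies H m n,
      V(K) = p₀ '' C ∪ ext y '' (V(H) \ C) ∧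
      ((n₀ : ℝ)⁻¹) ^ E(H).ncard * ∏ v ∈ A, ((ext y v : ℝ) - 1)⁻¹ ≤
        (choiceMeasure m n).real {ω | E(K) ⊆ chosenEdges ω} := by
    intro y hy
    refine exists_copy_of_block_placement hV hE hm hn₀ hp₀ hp₀V hlab hr₀ hr hrinj htop htopinj hb hn
      (ext y) fun v hv => ?_
    have := Fintype.mem_piFinset.1 hy ⟨v, (hmemA v).2 hv⟩
    rw [← hext y ⟨v, (hmemA v).2 hv⟩] at this
    exact this
  choose! K hK hVK hPK using hex
  -- The vertex set of the copy determines `y`: the blocks are disjoint from one another and from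
  -- the core positions, which are at most `n₀`.
  have hKinj : Set.InjOn K (Fintype.piFinset blocks) := by
    intro y hy y' hy' hyy
    have hVV : V(K y) = V(K y') := by rw [hyy]
    rw [hVK y hy, hVK y' hy'] at hVV
    funext v
    have hv := (hmemA v).1 v.2
    have hyv := Finset.mem_Ioc.1 (Fintype.mem_piFinset.1 hy v)
    have hmem : y v ∈ p₀ '' C ∪ ext y' '' (V(H) \ C) := by
      rw [← hVV, ← hext y v]
      exact Or.inr ⟨v, hv, rfl⟩
    rcases hmem with ⟨u, hu, huv⟩ | ⟨u, hu, huv⟩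
    · have h1 := (hp₀V u (hCV hu)).2
      have h2 : n₀ ≤ n₀ * b ^ (r v - 1) := Nat.le_mul_of_pos_right _ (Nat.pow_pos hb)
      omega
    · have huA := (hmemA u).2 hu
      have hyu := Finset.mem_Ioc.1 (Fintype.mem_piFinset.1 hy' ⟨u, huA⟩)
      rw [show ext y' u = y' ⟨u, huA⟩ from dif_pos huA] at huv
      rw [huv] at hyu
      have hmono : ∀ {i j : ℕ}, i ≤ j → n₀ * b ^ i ≤ n₀ * b ^ j := fun h =>
        Nat.mul_le_mul_left _ (Nat.pow_le_pow_right hb h)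
      have hruv : r u = r v := by
        rcases lt_trichotomy (r u) (r v) with h | h | h
        · have := hmono (show r u ≤ r v - 1 by omega)
          exact absurd (hyu.2.trans this) (not_le.2 hyv.1)
        · exact h
        · have := hmono (show r v ≤ r u - 1 by omega)
          exact absurd (hyv.2.trans this) (not_le.2 hyu.1)
      have huv' : (⟨u, huA⟩ : A) = v := Subtype.ext (hrinj hu hv hruv)
      rw [← huv, huv']
  have hAcard : Fintype.card A = (V(H) \ C).ncard := by
    rw [Fintype.card_coe, hA, ← Set.ncard_eq_toFinset_card _ (hV.sdiff (t := C))]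
  rw [integral_copyCount]
  calc ((n₀ : ℝ)⁻¹) ^ E(H).ncard * Real.log b ^ (V(H) \ C).ncard
      = ((n₀ : ℝ)⁻¹) ^ E(H).ncard * ∏ _v : A, Real.log b := by
        rw [Finset.prod_const, Finset.card_univ, hAcard]
    _ ≤ ((n₀ : ℝ)⁻¹) ^ E(H).ncard * ∏ v : A, ∑ x ∈ blocks v, ((x : ℝ) - 1)⁻¹ := by
        refine mul_le_mul_of_nonneg_left (Finset.prod_le_prod
          (fun v _ => Real.log_natCast_nonneg b) fun v _ => ?_) (by positivity)
        have h1 : 1 ≤ n₀ * b ^ (r v - 1) := Nat.mul_pos hn₀ (Nat.pow_pos hb)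
        have h2 : n₀ * b ^ (r v) = n₀ * b ^ (r v - 1) * b := by
          rw [mul_assoc, ← pow_succ, Nat.sub_add_cancel (hr v ((hmemA v).1 v.2)).1]
        simp only [blocks, h2]
        exact log_le_sum_block h1 hb
    -- Expanding the product of block sums yields one term per placement.
    _ = ∑ y ∈ Fintype.piFinset blocks,
          ((n₀ : ℝ)⁻¹) ^ E(H).ncard * ∏ v ∈ A, ((ext y v : ℝ) - 1)⁻¹ := by
        rw [Finset.prod_univ_sum, Finset.mul_sum]
        refine Finset.sum_congr rfl fun y _ => ?_
        rw [← Finset.prod_coe_sort A]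
        simp only [hext]
    _ ≤ ∑ y ∈ Fintype.piFinset blocks,
          (choiceMeasure m n).real {ω | E(K y) ⊆ chosenEdges ω} := Finset.sum_le_sum hPK
    _ = ∑ K ∈ (Fintype.piFinset blocks).image K,
          (choiceMeasure m n).real {ω | E(K) ⊆ chosenEdges ω} := by
        rw [Finset.sum_image hKinj]
    _ ≤ _ := by
        refine Finset.sum_le_sum_of_subset_of_nonneg ?_ fun _ _ _ => measureReal_nonneg
        intro L hL
        obtain ⟨y, hy, rfl⟩ := Finset.mem_image.1 hL
        exact hK y hy

end LowerBound

/-! ### Choice of the block ratio and conclusion -/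

lemma eventually_exists_pow_le (t n₀ : ℕ) : ∀ᶠ n : ℕ in atTop,
    ∃ b : ℕ, 1 ≤ b ∧ n₀ * b ^ t ≤ n ∧ Real.log n ≤ 2 * (t + 1) * Real.log b := by
  have hroot : Tendsto (fun n : ℕ => (n : ℝ) ^ (1 / (t + 1) : ℝ)) atTop atTop :=
    (tendsto_rpow_atTop (by positivity)).comp tendsto_natCast_atTop_atTop
  filter_upwards [hroot.eventually_ge_atTop (max 4 (n₀ + 1)), eventually_ge_atTop 1] with n hn hn1
  set x := (n : ℝ) ^ (1 / (t + 1) : ℝ) with hx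
  have hx4 : 4 ≤ x := (le_max_left _ _).trans hn
  have hxn₀ : (n₀ + 1 : ℝ) ≤ x := (le_max_right _ _).trans hn
  have hxpow : x ^ (t + 1) = n := by
    rw [hx, ← Real.rpow_natCast, ← Real.rpow_mul (Nat.cast_nonneg n)]
    push_cast
    rw [one_div, inv_mul_cancel₀ (by positivity), Real.rpow_one]
  have hbx : (⌊x⌋₊ : ℝ) ≤ x := Nat.floor_le (by linarith)
  have hxb : x < ⌊x⌋₊ + 1 := Nat.lt_floor_add_one x
  -- With `x = n^(1/(t+1))`, the exponent `t + 1` in place of `t` leaves a spare factor `⌊x⌋₊` that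
  -- absorbs `n₀`. The constant 2 in the logarithmic bound comes from `x ≤ ⌊x⌋₊ ^ 2`.
  refine ⟨⌊x⌋₊, Nat.le_floor (by norm_num; linarith), ?_, ?_⟩
  · have h1 : n₀ ≤ ⌊x⌋₊ := Nat.le_floor (by linarith)
    have h2 : (⌊x⌋₊ : ℝ) ^ (t + 1) ≤ n := hxpow ▸ pow_le_pow_left₀ (by positivity) hbx _
    calc n₀ * ⌊x⌋₊ ^ t ≤ ⌊x⌋₊ * ⌊x⌋₊ ^ t := Nat.mul_le_mul_right _ h1
      _ = ⌊x⌋₊ ^ (t + 1) := (pow_succ' _ _).symm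
      _ ≤ n := by exact_mod_cast h2
  · have h3 : (3 : ℝ) < ⌊x⌋₊ := by linarith
    have h4 : x ≤ (⌊x⌋₊ : ℝ) ^ 2 := by nlinarith
    have h5 : Real.log x ≤ 2 * Real.log ⌊x⌋₊ := by
      have := Real.log_le_log (by linarith) h4
      rwa [Real.log_pow, Nat.cast_ofNat] at this
    rw [← hxpow, Real.log_pow]
    push_cast
    nlinarith

end UniformAttachment

theorem theorem3p7 {α β : Type*} (H : Graph α β) (hV : V(H).Finite) (hE : E(H).Finite)
    (hloop : H.Loopless) (hconn : UniformAttachment.IsConnected H)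
    (hmulti : UniformAttachment.IsMulticyclic H)
    (m : ℕ) (hm : 1 ≤ m) (hmH : UniformAttachment.minLabels H ≤ m)
    (t : ℕ) (ht : t = (V(H) \ V(UniformAttachment.twoCore H)).ncard) :
    (fun n : ℕ => ∫ ω, UniformAttachment.copyCount H m n ω
        ∂(UniformAttachment.choiceMeasure m n))
      =Θ[Filter.atTop] (fun n : ℕ => Real.log n ^ t) ∧
    (fun n : ℕ => ProbabilityTheory.variance (UniformAttachment.copyCount H m n)
        (UniformAttachment.choiceMeasure m n))
      =O[Filter.atTop] (fun n : ℕ => Real.log n ^ (2 * t)) := by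
  obtain ⟨B, hB, hsq⟩ := UniformAttachment.exists_integral_copyCount_sq_le hm
    (UniformAttachment.twoCore_le H).vertexSet_mono
    fun S hS => UniformAttachment.ncard_le_ncard_touching hV hE hconn hmulti hS
  obtain ⟨n₀, hn₀, hlow⟩ :=
    UniformAttachment.exists_log_pow_le_integral_copyCount hV hE hconn.1 hm hmH
  rw [← ht] at hsq hlow
  have hlog : ∀ᶠ n : ℕ in Filter.atTop, 1 ≤ Real.log n :=
    (Real.tendsto_log_atTop.comp tendsto_natCast_atTop_atTop).eventually_ge_atTop 1
  have hnonneg : ∀ n, 0 ≤ ∫ ω, UniformAttachment.copyCount H m n ω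
      ∂(UniformAttachment.choiceMeasure m n) := fun n =>
    MeasureTheory.integral_nonneg fun ω => Nat.cast_nonneg _
  have hsq' : ∀ᶠ n : ℕ in Filter.atTop, ∫ ω, UniformAttachment.copyCount H m n ω ^ 2
      ∂(UniformAttachment.choiceMeasure m n) ≤ B * 2 ^ (2 * t) * Real.log n ^ (2 * t) := by
    filter_upwards [hlog] with n hn
    refine (hsq n).trans ?_
    -- Once `log n ≥ 1`, one has `1 + log n ≤ 2 log n`, whence the factor `2 ^ (2 * t)`.
    rw [mul_assoc, ← mul_pow]
    exact mul_le_mul_of_nonneg_left (pow_le_pow_left₀ (by linarith) (by linarith) _) hB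
  refine ⟨⟨?_, ?_⟩, ?_⟩
  · refine Asymptotics.IsBigO.of_bound (Real.sqrt (B * 2 ^ (2 * t))) ?_
    filter_upwards [hsq', hlog] with n hn hn1
    rw [Real.norm_of_nonneg (hnonneg n), Real.norm_of_nonneg (by positivity)]
    refine le_of_sq_le_sq ?_ (by positivity)
    rw [mul_pow, Real.sq_sqrt (by positivity), ← pow_mul, mul_comm t 2]
    exact (UniformAttachment.sq_integral_copyCount_le H m n).trans hn
  -- The constant combines the loss `2(t+1)` in passing from `log n` to `log b`, taken `t` times,
  -- with the core factor `n₀ ^ |E(H)|`.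
  · refine Asymptotics.IsBigO.of_bound ((2 * (t + 1)) ^ t * (n₀ : ℝ) ^ E(H).ncard) ?_
    filter_upwards [UniformAttachment.eventually_exists_pow_le t n₀, hlog]
      with n ⟨b, hb, hbn, hlb⟩ hn1
    rw [Real.norm_of_nonneg (hnonneg n), Real.norm_of_nonneg (by positivity)]
    have hn₀0 : (0 : ℝ) < n₀ := by exact_mod_cast hn₀
    calc Real.log n ^ t ≤ (2 * (t + 1) * Real.log b) ^ t := pow_le_pow_left₀ (by linarith) hlb _
      _ = (2 * (t + 1)) ^ t * (n₀ : ℝ) ^ E(H).ncard *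
            ((n₀ : ℝ)⁻¹ ^ E(H).ncard * Real.log b ^ t) := by
          rw [mul_pow, inv_pow]
          field_simp
      _ ≤ _ := mul_le_mul_of_nonneg_left (hlow b n hb hbn) (by positivity)
  · refine Asymptotics.IsBigO.of_bound (B * 2 ^ (2 * t)) ?_
    filter_upwards [hsq', hlog] with n hn hn1
    rw [Real.norm_of_nonneg (ProbabilityTheory.variance_nonneg _ _),
      Real.norm_of_nonneg (by positivity)]
    exact (UniformAttachment.variance_copyCount_le H m n).trans hn
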